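/- Let $a>0$ and $0<t<\frac{1}{a+4}$. Let $Q(x,y)=\sum_{n,i,j\ge 0}q(i,j;n)\,x^iy^jt^n$, where $q(i,j;n)$ is the weighted number of walks of length $n$ from $(0,0)$ to $(i,j)$ that stay in the quadrant $\mathbb{Z}_{\ge0}^2$ and use the steps $(1,0),(0,1),(-1,0),(0,-1)$ with weight $1$ and the step $(1,1)$ with weight $a$. For $\Im\tau>0$ let $$\theta(z|\tau)=\sum_{n\ge 0}(-1)^n e^{i\pi\tau(n+\frac12)^2}\bigl(e^{(2n+1)iz}-e^{-(2n+1)iz}\bigr),$$ and let $\theta'$ be its derivative in $z$. Let $c,\gamma,\tau\in\mathbb{C}$ with $\gamma,\tau\in i\mathbb{R}$ and $0<\Im(2\gamma)<\Im(\pi\tau)$ satisfy $$ac^3=-\frac{\theta(4\gamma|\tau)}{\theta(2\gamma|\tau)},\qquad c^2=\frac{\theta(3\gamma|\tau)}{\theta(\gamma|\tau)},\qquad \frac ct=4\frac{\theta'(\gamma|\tau)\theta(2\gamma|\tau)}{\theta'(0|\tau)\theta(\gamma|\tau)}-2\frac{\theta'(2\gamma|\tau)}{\theta'(0|\tau)},$$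 and put $$X(z)=c\,\frac{\theta(z|\tau)\theta(z+\gamma|\tau)}{\theta(z-\gamma|\tau)\theta(z+2\gamma|\tau)},\qquad Y(z)=X(-z).$$ Let $\Omega_X$ be the connected component of $\{z\in\mathbb{C}:|X(z)|<1\}$ containing $-\gamma/2$, and $\Omega_Y$ the connected component of $\{z\in\mathbb{C}:|Y(z)|<1\}$ containing $\gamma/2$. Then there is a unique meromorphic function $J$ on $\mathbb{C}$ such that $$J(z)=\frac1{2t}-atX(z)Q(X(z),0)-X(z)-\frac1{X(z)}\quad\text{on }\Omega_X,$$ $$J(z)=-\Bigl(\frac1{2t}-atY(z)Q(0,Y(z))-Y(z)-\frac1{Y(z)}\Bigr)\quad\text{on }\Omega_Y,$$ and it is given by $$J(z)=\frac{\theta'(0|\frac{\gamma}{\pi})\,\theta(2\gamma|\tau)\,\theta(z+\frac{\pi}{2}|\frac{\gamma}{\pi})}{c\,\theta(\frac{\pi}{2}|\frac{\gamma}{\pi})\,\theta'(0|\tau)\,\theta(z|\frac{\gamma}{\pi})}.$$ Consequently $Q(x,0)$ is given parametrically for $0<|x|<1$: every such $x$ equals $X(z)$ for some $z\in\Omega_X$,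 and for each such $z$ $$Q(x,0)=\frac{1}{atx}\Bigl(\frac1{2t}-x-\frac1x-J(z)\Bigr).$$ -/

import Mathlib

namespace QuadrantWalk

noncomputable section

/-- The Jacobi theta function
`θ(z | τ) = ∑_{n ≥ 0} (-1)^n e^{iπτ(n+1/2)^2} (e^{(2n+1)iz} - e^{-(2n+1)iz})`. -/
def theta (z τ : ℂ) : ℂ :=
  ∑' n : ℕ, (-1 : ℂ) ^ n * Complex.exp (Complex.I * Real.pi * τ * ((n : ℂ) + 1 / 2) ^ 2) *
    (Complex.exp ((2 * (n : ℂ) + 1) * Complex.I * z) -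
      Complex.exp (-((2 * (n : ℂ) + 1) * Complex.I * z)))

/-- The derivative `θ'(z | τ)` with respect to the first argument. -/
def theta' (z τ : ℂ) : ℂ := deriv (fun w => theta w τ) z

/-- The steps N, E, S, W and NE. -/
def steps : Finset (ℤ × ℤ) := {(0, 1), (1, 0), (0, -1), (-1, 0), (1, 1)}

/-- The weight of a step: `a` for NE and `1` for the other steps. -/
def stepWeight (a : ℝ) (s : ℤ × ℤ) : ℝ := if s = (1, 1) then a else 1

/-- The position reached after the first `k` steps of the walk `w` started at the origin. -/
def position {n : ℕ} (w : Fin n → ℤ × ℤ) (k : ℕ) : ℤ × ℤ :=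
  ∑ m : Fin n with m.val < k, w m

/-- The walks of length `n` that start at the origin, stay in the quadrant and end at `(i, j)`. -/
def walks (i j n : ℕ) : Finset (Fin n → ℤ × ℤ) :=
  {w ∈ Fintype.piFinset (fun _ : Fin n => steps) |
    (∀ k : Fin (n + 1), 0 ≤ (position w k).1 ∧ 0 ≤ (position w k).2) ∧
      position w n = ((i : ℤ), (j : ℤ))}

/-- The weighted number `q((0,0),(i,j);n)` of quadrant walks. -/
def walkCount (a : ℝ) (i j n : ℕ) : ℝ :=
  ∑ w ∈ walks i j n, ∏ m : Fin n, stepWeight a (w m)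

/-- The generating function `Q(x, y) = Q(x, y; t)`. -/
def Q (a t : ℝ) (x y : ℂ) : ℂ :=
  ∑' n : ℕ, ∑' i : ℕ, ∑' j : ℕ, (walkCount a i j n : ℂ) * x ^ i * y ^ j * (t : ℂ) ^ n

/-- The triple `(c, γ, τ)` attached to the parameters `(a, t)`. -/
structure IsUniformizingTriple (a t : ℝ) (c γ τ : ℂ) : Prop where
  gamma_re : γ.re = 0
  tau_re : τ.re = 0
  gamma_pos : 0 < (2 * γ).im
  gamma_lt : (2 * γ).im < (Real.pi * τ).im
  eq_ac3 : a * c ^ 3 = -(theta (4 * γ) τ / theta (2 * γ) τ)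
  eq_c2 : c ^ 2 = theta (3 * γ) τ / theta γ τ
  eq_c_on_t : c / t = 4 * ((theta' γ τ * theta (2 * γ) τ) / (theta' 0 τ * theta γ τ)) -
    2 * (theta' (2 * γ) τ / theta' 0 τ)

/-- `X(z)`; its poles are the zeros of the denominator. -/
def X (c γ τ z : ℂ) : ℂ :=
  c * ((theta z τ * theta (z + γ) τ) / (theta (z - γ) τ * theta (z + 2 * γ) τ))

/-- `Y(z)`; its poles are the zeros of the denominator. -/
def Y (c γ τ z : ℂ) : ℂ :=
  c * ((theta z τ * theta (z - γ) τ) / (theta (z + γ) τ * theta (z - 2 * γ) τ))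

/-- The region `Ω₋₁ ∪ Ω₀`: the connected component of `{z : |X(z)| < 1}` (the poles of `X` being
left out) that contains `-γ/2`. -/
def regionX (c γ τ : ℂ) : Set ℂ :=
  connectedComponentIn
    {z : ℂ | theta (z - γ) τ * theta (z + 2 * γ) τ ≠ 0 ∧ ‖X c γ τ z‖ < 1} (-(γ / 2))

/-- The region `Ω₀ ∪ Ω₁`: the connected component of `{z : |Y(z)| < 1}` (the poles of `Y` being
left out) that contains `γ/2`. -/
def regionY (c γ τ : ℂ) : Set ℂ :=
  connectedComponentIn
    {z : ℂ | theta (z + γ) τ * theta (z - 2 * γ) τ ≠ 0 ∧ ‖Y c γ τ z‖ < 1} (γ / 2)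

/-- `J` is (a representative of) the decoupled function: a meromorphic function on `ℂ` that is given
by the generating function `Q(x, 0)` on `Ω₋₁ ∪ Ω₀` and by `Q(0, y)` on `Ω₀ ∪ Ω₁`, away from the
zeros of `X` and `Y`, respectively. -/
structure IsDecoupledFunction (a t : ℝ) (c γ τ : ℂ) (J : ℂ → ℂ) : Prop where
  meromorphic : Meromorphic J
  eq_on_regionX : ∀ z ∈ regionX c γ τ, X c γ τ z ≠ 0 →
    J z = 1 / (2 * t) - a * t * X c γ τ z * Q a t (X c γ τ z) 0 - X c γ τ z - 1 / X c γ τ z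
  eq_on_regionY : ∀ z ∈ regionY c γ τ, Y c γ τ z ≠ 0 →
    J z = -(1 / (2 * t) - a * t * Y c γ τ z * Q a t 0 (Y c γ τ z) - Y c γ τ z - 1 / Y c γ τ z)

/-- The explicit theta quotient. -/
def thetaQuotient (c γ τ z : ℂ) : ℂ :=
  (theta' 0 (γ / Real.pi) * theta (2 * γ) τ * theta (z + Real.pi / 2) (γ / Real.pi)) /
    (c * theta (Real.pi / 2) (γ / Real.pi) * theta' 0 τ * theta z (γ / Real.pi))

end

end QuadrantWalk

namespace QuadrantWalk

open Filter Topology Set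

/-! ### Entire functions: division by simple zeros and doubly periodic functions -/

/-! Put F(x) = 1/(2t) - atxQ(x,0) - x - 1/x. The pair (X(z), Y(z)) parametrizes the kernel curve 1/t
= x + y + 1/x + 1/y + axy (`kernel_XY`). The reason is that the kernel, cleared of denominators, is
an elliptic multiple of the common denominator; the first two equations for (c, γ, τ) remove its
poles, so that it is a constant multiple, and the third makes the constant zero
(`kernelNumerator_eq_zero`).

On the curve, where |x|, |y| ≤ 1, the functional equation of the walks reduces to txQ(x,0) +
tyQ(0,y) = xy (`Q_kernel`). Multiplied by a, this replaces the mixed term axy of the kernel by a sum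
of a function of x and a function of y, and the result reads F(X(z)) = -F(Y(z)), as Q is symmetric.
Since Y(z) = X(-z), the function F ∘ X is odd near the real axis; it is also invariant under z ↦ -γ
- z and z ↦ z + π, because X is.

The strip -Im γ ≤ Im z ≤ 0 satisfies |X| < 1 (`norm_X_lt_one`), so there F ∘ X can have poles only
at the zeros of X, namely πℤ and -γ + πℤ. The theta quotient of period parameter γ/π has the same
symmetries, the same poles and the same residues. Hence the difference extends analytically over the
strip and attains its maximal modulus there. By the two reflections a maximum on the boundary is
still a local maximum in the plane, so the difference is constant, and being odd it is zero
(`fillIn_discrepancy_eq_zero`).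

The identity theorem carries the equality to the whole region (`decoupled_identity`) and also gives
uniqueness (`eventually_codiscrete_eq`). The parametrization reaches every x in the disk because the
image of the region under X is open, and closed relative to the disk (`exists_mem_regionX`). -/

/-- Every zero of `f` is simple. -/
def HasSimpleZeros (f : ℂ → ℂ) : Prop := ∀ z, f z = 0 → deriv f z ≠ 0

lemma HasSimpleZeros.mul {f g : ℂ → ℂ} (hf : HasSimpleZeros f) (hg : HasSimpleZeros g)
    (df : Differentiable ℂ f) (dg : Differentiable ℂ g) (hfg : ∀ z, f z = 0 → g z ≠ 0) :
    HasSimpleZeros (fun z => f z * g z) := by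
  intro z hz
  rw [deriv_fun_mul (df z) (dg z)]
  by_cases h : f z = 0
  · rw [h, zero_mul, add_zero]
    exact mul_ne_zero (hf z h) (hfg z h)
  · have h' : g z = 0 := (mul_eq_zero.1 hz).resolve_left h
    rw [h', mul_zero, zero_add]
    exact mul_ne_zero h (hg z h')

lemma HasSimpleZeros.comp_add {f : ℂ → ℂ} (hf : HasSimpleZeros f) (s : ℂ) :
    HasSimpleZeros (fun z => f (z + s)) := by
  intro z hz
  rw [deriv_comp_add_const]
  exact hf _ hz

/-- Division of `p` by a function with simple zeros at which `p` vanishes. -/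
lemma exists_entire_quotient {p f : ℂ → ℂ} (hp : Differentiable ℂ p) (df : Differentiable ℂ f)
    (hf : HasSimpleZeros f) (h : ∀ z, f z = 0 → p z = 0) :
    ∃ r : ℂ → ℂ, Differentiable ℂ r ∧ ∀ z, p z = r z * f z := by
  classical
  refine ⟨fun z => if f z = 0 then deriv p z / deriv f z else p z / f z, fun z => ?_, fun z => ?_⟩
  · by_cases hz : f z = 0
    -- At a common zero both functions lose the factor w - z; the quotient of the divided
    -- differences is analytic because the one of `f` equals `deriv f z ≠ 0` at `z`.
    · have h1 : DifferentiableAt ℂ (fun w => dslope p z w / dslope f z w) z := by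
        have e1 : DifferentiableOn ℂ (dslope p z) univ :=
          (Complex.differentiableOn_dslope univ_mem).2 hp.differentiableOn
        have e2 : DifferentiableOn ℂ (dslope f z) univ :=
          (Complex.differentiableOn_dslope univ_mem).2 df.differentiableOn
        refine (e1.differentiableAt univ_mem).div (e2.differentiableAt univ_mem) ?_
        rw [dslope_same]
        exact hf z hz
      refine h1.congr_of_eventuallyEq ?_
      have hne : ∀ᶠ w in 𝓝 z, dslope f z w ≠ 0 := by
        refine ContinuousAt.eventually_ne ?_ (by rw [dslope_same]; exact hf z hz)
        exact continuousAt_dslope_same.2 (df z)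
      filter_upwards [hne] with w hw
      by_cases hwz : w = z
      · subst hwz
        simp [hz, dslope_same]
      · rw [dslope_of_ne _ hwz, dslope_of_ne _ hwz] at *
        rw [slope_def_field, hz, sub_zero] at hw
        have : f w ≠ 0 := fun h0 => hw (by simp [h0])
        rw [if_neg this, slope_def_field, slope_def_field, hz, h z hz, sub_zero, sub_zero]
        have := sub_ne_zero.2 hwz
        field_simp
    · refine ((hp z).div (df z) hz).congr_of_eventuallyEq ?_
      filter_upwards [(df z).continuousAt.eventually_ne hz] with w hw
      simp [hw]
  · by_cases hz : f z = 0
    · simp [hz, h z hz]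
    · simp [hz]

/-- Every complex number is congruent, modulo the lattice `ℤ π + ℤ π τ`, to a point of the
fundamental parallelogram. -/
lemma exists_lattice_translate {τ : ℂ} (hτ : 0 < τ.im) (z : ℂ) :
    ∃ m n : ℤ, ∃ x ∈ Icc (0 : ℝ) 1, ∃ y ∈ Icc (0 : ℝ) 1,
      z + (m * Real.pi + n * (Real.pi * τ)) = x * Real.pi + y * (Real.pi * τ) := by
  have hπ := Real.pi_pos
  set v : ℝ := z.im / (Real.pi * τ.im) with hv
  set u : ℝ := (z.re - v * (Real.pi * τ.re)) / Real.pi with hu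
  have hz : z = u * Real.pi + v * (Real.pi * τ) := by
    apply Complex.ext
    · simp [hu]
    · simp only [Complex.add_im, Complex.mul_im, Complex.ofReal_re, Complex.ofReal_im, mul_zero,
        zero_mul, add_zero, zero_add, Complex.mul_re, sub_zero]
      rw [hv]
      field_simp
  refine ⟨-⌊u⌋, -⌊v⌋, Int.fract u, ⟨Int.fract_nonneg u, (Int.fract_lt_one u).le⟩,
    Int.fract v, ⟨Int.fract_nonneg v, (Int.fract_lt_one v).le⟩, ?_⟩
  rw [hz]
  rw [Int.fract, Int.fract]
  push_cast
  ring

/-- The fundamental parallelogram of the lattice `ℤ π + ℤ π τ`. -/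
def fundamentalCell (τ : ℂ) : Set ℂ :=
  (fun p : ℝ × ℝ => (p.1 : ℂ) * Real.pi + p.2 * (Real.pi * τ)) '' (Icc 0 1 ×ˢ Icc 0 1)

lemma isCompact_fundamentalCell (τ : ℂ) : IsCompact (fundamentalCell τ) := by
  refine (isCompact_Icc.prod isCompact_Icc).image ?_
  fun_prop

lemma exists_translate_mem_fundamentalCell {τ : ℂ} (hτ : 0 < τ.im) (z : ℂ) :
    ∃ m n : ℤ, z + (m * Real.pi + n * (Real.pi * τ)) ∈ fundamentalCell τ := by
  obtain ⟨m, n, x, hx, y, hy, h⟩ := exists_lattice_translate hτ z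
  exact ⟨m, n, (x, y), ⟨hx, hy⟩, h.symm⟩

lemma periodic_lattice {f : ℂ → ℂ} {τ : ℂ} (h1 : ∀ z, f (z + Real.pi) = f z)
    (h2 : ∀ z, f (z + Real.pi * τ) = f z) (m n : ℤ) (z : ℂ) :
    f (z + (m * Real.pi + n * (Real.pi * τ))) = f z := by
  have p1 : Function.Periodic f (Real.pi : ℂ) := h1
  have p2 : Function.Periodic f (Real.pi * τ) := h2
  rw [← add_assoc, p2.int_mul n, p1.int_mul m]

/-- Liouville's theorem for doubly periodic functions. -/
lemma eq_of_doublyPeriodic {f : ℂ → ℂ} {τ : ℂ} (hτ : 0 < τ.im) (hf : Differentiable ℂ f)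
    (h1 : ∀ z, f (z + Real.pi) = f z) (h2 : ∀ z, f (z + Real.pi * τ) = f z) (z w : ℂ) :
    f z = f w := by
  refine hf.apply_eq_apply_of_bounded ?_ z w
  refine (((isCompact_fundamentalCell τ).image hf.continuous).isBounded).subset ?_
  rintro _ ⟨z, rfl⟩
  obtain ⟨m, n, h⟩ := exists_translate_mem_fundamentalCell hτ z
  exact ⟨_, h, periodic_lattice h1 h2 m n z⟩

/-- If `p` and `f` have the same multipliers under `z ↦ z + ω` and `p = r f`, then `r` is
`ω`-periodic. -/
lemma periodic_quotient {p f r u : ℂ → ℂ} {ω : ℂ} (hr : Continuous r) (df : Differentiable ℂ f)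
    (hne : ∃ z, f z ≠ 0) (hu : ∀ z, u z ≠ 0)
    (hprf : ∀ z, p z = r z * f z) (hp : ∀ z, p (z + ω) = u z * p z)
    (hf : ∀ z, f (z + ω) = u z * f z) (z : ℂ) : r (z + ω) = r z := by
  obtain ⟨z₀, hz₀⟩ := hne
  -- The multiplier can be cancelled only where `f` does not vanish; this set is dense by the
  -- identity theorem, and continuity of `r` does the rest.
  have hd : Dense {z | f z ≠ 0} := by
    have han : AnalyticOnNhd ℂ f univ := fun z _ => df.analyticAt z
    rw [dense_iff_closure_eq, eq_univ_iff_forall]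
    intro z
    rcases (han z trivial).eventually_eq_zero_or_eventually_ne_zero with h | h
    · exact absurd (han.eqOn_zero_of_preconnected_of_eventuallyEq_zero isPreconnected_univ
        trivial h trivial) hz₀
    · rw [mem_closure_iff_frequently]
      exact (h.frequently).filter_mono nhdsWithin_le_nhds
  refine congrFun (Continuous.ext_on hd (hr.comp (continuous_add_const ω)) hr fun z hz => ?_) z
  have h := hprf (z + ω)
  rw [hp, hf, hprf] at h
  have hz' : f z ≠ 0 := hz
  have : (r (z + ω) - r z) * (u z * f z) = 0 := by linear_combination -h
  exact sub_eq_zero.1 ((mul_eq_zero.1 this).resolve_right (mul_ne_zero (hu z) hz'))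

/-! ### The Jacobi theta function -/

/-- The bilateral series is folded by pairing the index n with -(n + 1). This makes θ entire and
gives its quasi-periodicity. -/
lemma theta_eq_jacobiTheta₂ {τ : ℂ} (hτ : 0 < τ.im) (z : ℂ) :
    theta z τ = Complex.exp (Complex.I * Real.pi * τ / 4 + Complex.I * z) *
      jacobiTheta₂ (z / Real.pi + 1 / 2 + τ / 2) τ := by
  have hπ : (Real.pi : ℂ) ≠ 0 := by exact_mod_cast Real.pi_ne_zero
  have h := (hasSum_jacobiTheta₂_term (z / Real.pi + 1 / 2 + τ / 2) hτ).mul_left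
    (Complex.exp (Complex.I * Real.pi * τ / 4 + Complex.I * z))
  have h2 := (HasSum.of_nat_of_neg_add_one
    (f := fun n : ℤ => Complex.exp (Complex.I * Real.pi * τ / 4 + Complex.I * z) *
      jacobiTheta₂_term n (z / Real.pi + 1 / 2 + τ / 2) τ)
    (h.summable.comp_injective Nat.cast_injective).hasSum
    ((h.summable.comp_injective (i := fun n : ℕ => (-(n + 1 : ℤ)))
      (fun a b hab => by simpa using hab)).hasSum))
  rw [h.unique h2, ← Summable.tsum_add, theta]
  · refine tsum_congr fun n => ?_
    have key : ∀ m : ℤ, Complex.exp (Complex.I * Real.pi * τ / 4 + Complex.I * z) *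
        jacobiTheta₂_term m (z / Real.pi + 1 / 2 + τ / 2) τ =
        (-1 : ℂ) ^ m * Complex.exp (Complex.I * Real.pi * τ * ((m : ℂ) + 1 / 2) ^ 2) *
          Complex.exp ((2 * (m : ℂ) + 1) * Complex.I * z) := by
      intro m
      have e : (-1 : ℂ) ^ m = Complex.exp (m * (Real.pi * Complex.I)) := by
        rw [Complex.exp_int_mul, Complex.exp_pi_mul_I]
      rw [e, jacobiTheta₂_term, ← Complex.exp_add, ← Complex.exp_add, ← Complex.exp_add]
      congr 1
      field_simp
      ring
    simp only [Function.comp_apply]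
    rw [key, key]
    have e1 : (-1 : ℂ) ^ (-((n : ℤ) + 1)) = -(-1) ^ n := by
      rw [zpow_neg, ← inv_zpow, ← Nat.cast_succ, zpow_natCast, pow_succ]
      norm_num
    rw [e1, zpow_natCast]
    push_cast
    have e2 : (-((n : ℂ) + 1) + 1 / 2) ^ 2 = ((n : ℂ) + 1 / 2) ^ 2 := by ring
    have e3 : (2 * -((n : ℂ) + 1) + 1) * Complex.I * z = -((2 * (n : ℂ) + 1) * Complex.I * z) := by
      ring
    rw [e2, e3]
    ring
  · exact h.summable.comp_injective Nat.cast_injective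
  · exact h.summable.comp_injective (i := fun n : ℕ => (-(n + 1 : ℤ)))
      (fun a b hab => by simpa using hab)

lemma differentiable_theta {τ : ℂ} (hτ : 0 < τ.im) : Differentiable ℂ (fun z => theta z τ) := by
  have : (fun z => theta z τ) = fun z =>
      Complex.exp (Complex.I * Real.pi * τ / 4 + Complex.I * z) *
      jacobiTheta₂ (z / Real.pi + 1 / 2 + τ / 2) τ := funext (theta_eq_jacobiTheta₂ hτ)
  rw [this]
  intro z
  refine DifferentiableAt.mul (by fun_prop) ?_
  exact DifferentiableAt.comp z (f := fun z : ℂ => z / Real.pi + 1 / 2 + τ / 2)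
    (g := fun w => jacobiTheta₂ w τ) (differentiableAt_jacobiTheta₂_fst _ hτ) (by fun_prop)

lemma continuous_theta {τ : ℂ} (hτ : 0 < τ.im) : Continuous (fun z => theta z τ) :=
  (differentiable_theta hτ).continuous

lemma hasDerivAt_theta {τ : ℂ} (hτ : 0 < τ.im) (z : ℂ) :
    HasDerivAt (fun w => theta w τ) (theta' z τ) z :=
  (differentiable_theta hτ z).hasDerivAt

@[simp]
lemma theta_neg (z τ : ℂ) : theta (-z) τ = -theta z τ := by
  rw [theta, theta, ← tsum_neg]
  refine tsum_congr fun n => ?_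
  rw [mul_neg, neg_neg]
  ring

@[simp]
lemma theta_zero (τ : ℂ) : theta 0 τ = 0 := by simp [theta]

lemma theta_add_pi {τ : ℂ} (z : ℂ) : theta (z + Real.pi) τ = -theta z τ := by
  rw [theta, theta, ← tsum_neg]
  refine tsum_congr fun n => ?_
  have e : Complex.exp ((2 * (n : ℂ) + 1) * Complex.I * Real.pi) = -1 := by
    have : (2 * (n : ℂ) + 1) * Complex.I * Real.pi =
      (n : ℂ) * (2 * Real.pi * Complex.I) + Real.pi * Complex.I := by ring
    rw [this, Complex.exp_add, Complex.exp_nat_mul_two_pi_mul_I, Complex.exp_pi_mul_I, one_mul]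
  rw [mul_add, neg_add, Complex.exp_add, Complex.exp_add, Complex.exp_neg (_ * (Real.pi : ℂ)), e]
  norm_num
  ring

lemma theta_add_pi_mul {τ : ℂ} (hτ : 0 < τ.im) (z : ℂ) :
    theta (z + Real.pi * τ) τ =
      -Complex.exp (-(Complex.I * Real.pi * τ)) * Complex.exp (-(2 * Complex.I * z)) *
        theta z τ := by
  have hπ : (Real.pi : ℂ) ≠ 0 := by exact_mod_cast Real.pi_ne_zero
  rw [theta_eq_jacobiTheta₂ hτ, theta_eq_jacobiTheta₂ hτ]
  have : (z + Real.pi * τ) / Real.pi + 1 / 2 + τ / 2 = (z / Real.pi + 1 / 2 + τ / 2) + τ := by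
    field_simp
    ring
  have em : (-1 : ℂ) = Complex.exp (-(Real.pi * Complex.I)) := by
    rw [Complex.exp_neg, Complex.exp_pi_mul_I]; norm_num
  rw [this, jacobiTheta₂_add_left', neg_eq_neg_one_mul (Complex.exp _), em]
  simp only [← mul_assoc, ← Complex.exp_add]
  congr 2
  field_simp
  ring

/-- Translation of `θ` by a lattice vector. -/
lemma exists_theta_add_lattice {τ : ℂ} (hτ : 0 < τ.im) (m n : ℤ) :
    ∃ κ : ℂ, κ ≠ 0 ∧ ∀ w, theta (w + (m * Real.pi + n * (Real.pi * τ))) τ =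
      κ * Complex.exp (-(2 * Complex.I * n) * w) * theta w τ := by
  have hn : ∃ κ : ℂ, κ ≠ 0 ∧ ∀ w, theta (w + n * (Real.pi * τ)) τ =
      κ * Complex.exp (-(2 * Complex.I * n) * w) * theta w τ := by
    induction n using Int.induction_on with
    | zero => exact ⟨1, one_ne_zero, fun w => by simp⟩
    | succ n ih =>
      obtain ⟨κ, h0, h⟩ := ih
      refine ⟨κ * -Complex.exp (-(Complex.I * Real.pi * τ)) *
        Complex.exp (-(2 * Complex.I * n) * (Real.pi * τ)),
        mul_ne_zero (mul_ne_zero h0 (neg_ne_zero.2 (Complex.exp_ne_zero _)))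
          (Complex.exp_ne_zero _), fun w => ?_⟩
      have e : w + (((n : ℤ) + 1 : ℤ) : ℂ) * (Real.pi * τ) =
        (w + Real.pi * τ) + ((n : ℤ) : ℂ) * (Real.pi * τ) := by push_cast; ring
      rw [e, h, theta_add_pi_mul hτ, mul_add, Complex.exp_add]
      push_cast
      have e2 : -(2 * Complex.I * ((n : ℂ) + 1)) * w =
        -(2 * Complex.I * n) * w + -(2 * Complex.I * w) := by ring
      rw [e2, Complex.exp_add]
      ring
    | pred n ih =>
      obtain ⟨κ, h0, h⟩ := ih
      refine ⟨κ * -Complex.exp (-(Complex.I * Real.pi * τ)) *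
        Complex.exp (-(2 * Complex.I * n) * (Real.pi * τ)),
        mul_ne_zero (mul_ne_zero h0 (neg_ne_zero.2 (Complex.exp_ne_zero _)))
          (Complex.exp_ne_zero _), fun w => ?_⟩
      have h1 := h (w - Real.pi * τ)
      have h2 := theta_add_pi_mul hτ (w - Real.pi * τ)
      have e : w + ((-(n : ℤ) - 1 : ℤ) : ℂ) * (Real.pi * τ) =
        (w - Real.pi * τ) + ((-(n : ℤ) : ℤ) : ℂ) * (Real.pi * τ) := by push_cast; ring
      rw [e, h1]
      rw [sub_add_cancel] at h2
      rw [h2]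
      push_cast
      simp only [← mul_assoc, mul_neg, neg_mul, neg_neg]
      congr 1
      rw [mul_assoc κ, mul_assoc κ, mul_assoc κ, mul_assoc κ]
      simp only [← Complex.exp_add]
      congr 2
      ring
  obtain ⟨κ, h0, h⟩ := hn
  have hm : ∀ w, theta (w + m * Real.pi) τ = (-1) ^ m * theta w τ := by
    induction m using Int.induction_on with
    | zero => intro w; simp
    | succ m ih =>
      intro w
      have e : w + (((m : ℤ) + 1 : ℤ) : ℂ) * Real.pi = (w + Real.pi) + ((m : ℤ) : ℂ) * Real.pi := by
        push_cast; ring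
      rw [e, ih, theta_add_pi, zpow_add_one₀ (by norm_num)]
      ring
    | pred m ih =>
      intro w
      have e : w + ((-(m : ℤ) - 1 : ℤ) : ℂ) * Real.pi =
        (w - Real.pi) + ((-(m : ℤ) : ℤ) : ℂ) * Real.pi := by push_cast; ring
      have h1 := theta_add_pi (τ := τ) (w - Real.pi)
      rw [sub_add_cancel] at h1
      rw [e, ih, h1, zpow_sub_one₀ (by norm_num)]
      norm_num
  refine ⟨κ * (-1) ^ m * Complex.exp (-(2 * Complex.I * n) * (m * Real.pi)),
    mul_ne_zero (mul_ne_zero h0 (zpow_ne_zero _ (by norm_num))) (Complex.exp_ne_zero _),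
    fun w => ?_⟩
  rw [← add_assoc, h, hm, mul_add, Complex.exp_add]
  ring

lemma theta_lattice {τ : ℂ} (hτ : 0 < τ.im) (m n : ℤ) :
    theta (m * Real.pi + n * (Real.pi * τ)) τ = 0 := by
  obtain ⟨κ, -, h⟩ := exists_theta_add_lattice hτ m n
  have := h 0
  rwa [zero_add, theta_zero, mul_zero] at this

/-- For purely imaginary τ the coefficients are real, while conjugation exchanges the two
exponentials of each term up to z ↦ z̄. This is the source of the reality of c and of the relation
between X and Y on the real line. -/
lemma theta_conj {τ : ℂ} (hre : τ.re = 0) (z : ℂ) :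
    (starRingEnd ℂ) (theta z τ) = -theta ((starRingEnd ℂ) z) τ := by
  have hc : (starRingEnd ℂ) τ = -τ := by
    apply Complex.ext <;> simp [hre]
  rw [theta, theta, Complex.conj_tsum, ← tsum_neg]
  refine tsum_congr fun n => ?_
  simp only [map_mul, map_sub, map_pow, map_neg, map_one, ← Complex.exp_conj, Complex.conj_I,
    Complex.conj_ofReal, hc, map_add, map_div₀, map_natCast, map_ofNat]
  ring_nf

/-- At π/2 the signs cancel and every term is 2i times a positive real number. -/
lemma theta_pi_div_two_ne_zero {τ : ℂ} (hre : τ.re = 0) (hτ : 0 < τ.im) :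
    theta (Real.pi / 2) τ ≠ 0 := by
  have hτ' : τ = τ.im * Complex.I := by
    apply Complex.ext <;> simp [hre]
  set s := τ.im
  have hterm : ∀ n : ℕ, (-1 : ℂ) ^ n *
      Complex.exp (Complex.I * Real.pi * τ * ((n : ℂ) + 1 / 2) ^ 2) *
      (Complex.exp ((2 * (n : ℂ) + 1) * Complex.I * (Real.pi / 2)) -
      Complex.exp (-((2 * (n : ℂ) + 1) * Complex.I * (Real.pi / 2)))) =
      2 * Complex.I * ((Real.exp (-(Real.pi * s * (n + 1 / 2) ^ 2)) : ℝ) : ℂ) := by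
    intro n
    have e : Complex.exp ((2 * (n : ℂ) + 1) * Complex.I * (Real.pi / 2)) =
        (-1) ^ n * Complex.I := by
      have : (2 * (n : ℂ) + 1) * Complex.I * (Real.pi / 2) =
        n * (Real.pi * Complex.I) + Real.pi / 2 * Complex.I := by ring
      rw [this, Complex.exp_add, Complex.exp_nat_mul, Complex.exp_pi_mul_I,
        Complex.exp_pi_div_two_mul_I]
    have e' : Complex.exp (Complex.I * Real.pi * τ * ((n : ℂ) + 1 / 2) ^ 2) =
        ((Real.exp (-(Real.pi * s * (n + 1 / 2) ^ 2)) : ℝ) : ℂ) := by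
      push_cast
      congr 1
      rw [hτ']
      linear_combination (Real.pi * s * ((n : ℂ) + 1 / 2) ^ 2) * Complex.I_sq
    have e2 : ((-1 : ℂ) ^ n) * (-1) ^ n = 1 := by
      rw [← mul_pow]; norm_num
    have e3 : ((-1 : ℂ) ^ n)⁻¹ = (-1) ^ n := by rw [← inv_pow]; norm_num
    rw [Complex.exp_neg, e, e', mul_inv, e3, Complex.inv_I]
    linear_combination (2 * Complex.I * ((Real.exp (-(Real.pi * s * (n + 1 / 2) ^ 2)) : ℝ) : ℂ)) * e2
  have hsum : Summable fun n : ℕ => Real.exp (-(Real.pi * s * (n + 1 / 2) ^ 2)) := by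
    have hps : 0 < Real.pi * s := mul_pos Real.pi_pos hτ
    refine Summable.of_nonneg_of_le (fun n => (Real.exp_pos _).le) (fun n => ?_)
      (Real.summable_exp_nat_mul_iff.2 (neg_lt_zero.2 hps))
    apply Real.exp_le_exp.2
    nlinarith [sq_nonneg (n : ℝ)]
  rw [theta, tsum_congr hterm, tsum_mul_left, ← Complex.ofReal_tsum]
  refine mul_ne_zero (mul_ne_zero two_ne_zero Complex.I_ne_zero) (Complex.ofReal_ne_zero.2 ?_)
  exact (hsum.tsum_pos (fun n => (Real.exp_pos _).le) 0 (Real.exp_pos _)).ne'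

/-! ### Product formula and zeros of the theta function -/

/-- The product `∏ (1 - p^n w)`. -/
noncomputable def qProduct (p w : ℂ) : ℂ := ∏' n : ℕ, (1 - p ^ n * w)

lemma multipliable_qProduct {p : ℂ} (hp : ‖p‖ < 1) (w : ℂ) :
    Multipliable fun n : ℕ => 1 - p ^ n * w := by
  simp_rw [sub_eq_add_neg]
  apply multipliable_one_add_of_summable
  simpa using (summable_geometric_of_lt_one (norm_nonneg _) hp).mul_right ‖w‖

lemma qProduct_eq {p : ℂ} (hp : ‖p‖ < 1) (w : ℂ) :
    qProduct p w = (1 - w) * qProduct p (p * w) := by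
  have hs : (fun n : ℕ => 1 - p ^ (n + 1) * w) = fun n : ℕ => 1 - p ^ n * (p * w) := by
    funext n
    ring
  have hm : Multipliable fun n : ℕ => 1 - p ^ (n + 1) * w := by
    rw [hs]
    exact multipliable_qProduct hp (p * w)
  have key := tprod_eq_zero_mul' (f := fun n : ℕ => 1 - p ^ n * w) hm
  rw [hs, pow_zero, one_mul] at key
  exact key

lemma qProduct_ne_zero {p w : ℂ} (hp : ‖p‖ < 1) (hw : ∀ n : ℕ, p ^ n * w ≠ 1) :
    qProduct p w ≠ 0 := by
  rw [qProduct]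
  simp_rw [sub_eq_add_neg]
  refine tprod_one_add_ne_zero_of_summable (f := fun n => -(p ^ n * w)) (fun n h => hw n ?_) ?_
  · linear_combination -h
  · simpa using (summable_geometric_of_lt_one (norm_nonneg _) hp).mul_right ‖w‖

lemma differentiable_qProduct {p : ℂ} (hp : ‖p‖ < 1) : Differentiable ℂ (qProduct p) := by
  have h : HasProdLocallyUniformlyOn (fun (n : ℕ) w => 1 - p ^ n * w) (qProduct p) univ := by
    simp_rw [sub_eq_add_neg]
    refine hasProdLocallyUniformlyOn_of_forall_compact isOpen_univ fun K _ hK => ?_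
    obtain ⟨R, hR⟩ := hK.isBounded.exists_norm_le
    have := ((summable_geometric_of_lt_one (norm_nonneg _) hp).mul_right R).hasProdUniformlyOn_nat_one_add
      hK (f := fun n w => -(p ^ n * w)) (.of_forall fun n x hx => ?_) (fun _ => by fun_prop)
    · have e : qProduct p = fun x => ∏' i : ℕ, (1 + -(p ^ i * x)) := by
        funext x
        simp [qProduct, sub_eq_add_neg]
      rw [e]
      exact this
    · simpa using mul_le_mul_of_nonneg_left (hR x hx) (by positivity)
  rw [← differentiableOn_univ]
  exact h.differentiableOn (.of_forall fun s ↦ by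
    simpa only [Finset.prod_fn] using
      DifferentiableOn.fun_finsetProd (u := s) (fun _ _ ↦ by fun_prop)) isOpen_univ

/-- The product `e^{-iz} ∏_{n ≥ 0} (1 - q^{2n} e^{2iz}) ∏_{n ≥ 1} (1 - q^{2n} e^{-2iz})`. -/
noncomputable def thetaProd (z τ : ℂ) : ℂ :=
  Complex.exp (-(Complex.I * z)) *
    (qProduct (Complex.exp (2 * Complex.I * (Real.pi * τ))) (Complex.exp (2 * Complex.I * z)) *
    qProduct (Complex.exp (2 * Complex.I * (Real.pi * τ)))
      (Complex.exp (2 * Complex.I * (Real.pi * τ - z))))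

lemma norm_nome_lt_one {τ : ℂ} (hτ : 0 < τ.im) :
    ‖Complex.exp (2 * Complex.I * (Real.pi * τ))‖ < 1 := by
  rw [Complex.norm_exp, Real.exp_lt_one_iff]
  simp
  positivity

lemma differentiable_thetaProd {τ : ℂ} (hτ : 0 < τ.im) :
    Differentiable ℂ (fun z => thetaProd z τ) := by
  have h := differentiable_qProduct (norm_nome_lt_one hτ)
  unfold thetaProd
  refine Differentiable.mul (by fun_prop) (Differentiable.mul ?_ ?_)
  · exact h.comp (f := fun z => Complex.exp (2 * Complex.I * z)) (by fun_prop)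
  · exact h.comp (f := fun z => Complex.exp (2 * Complex.I * (Real.pi * τ - z))) (by fun_prop)

lemma thetaProd_add_pi (τ z : ℂ) : thetaProd (z + Real.pi) τ = -thetaProd z τ := by
  have e1 : Complex.exp (-(Complex.I * (z + Real.pi))) = -Complex.exp (-(Complex.I * z)) := by
    rw [mul_add, neg_add, Complex.exp_add, Complex.exp_neg (_ * (Real.pi : ℂ)), mul_comm Complex.I,
      mul_comm Complex.I, Complex.exp_pi_mul_I]
    norm_num
  have e2 : Complex.exp (2 * Complex.I * (z + Real.pi)) = Complex.exp (2 * Complex.I * z) := by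
    rw [mul_add, Complex.exp_add, show 2 * Complex.I * (Real.pi : ℂ) = 2 * Real.pi * Complex.I by
      ring, Complex.exp_two_pi_mul_I, mul_one]
  have e3 : Complex.exp (2 * Complex.I * (Real.pi * τ - (z + Real.pi))) =
      Complex.exp (2 * Complex.I * (Real.pi * τ - z)) := by
    rw [← sub_sub, mul_sub, Complex.exp_sub, show 2 * Complex.I * (Real.pi : ℂ) =
      2 * Real.pi * Complex.I by ring, Complex.exp_two_pi_mul_I, div_one]
  rw [thetaProd, thetaProd, e1, e2, e3]
  ring

/-- The shift moves one factor between the two products, and 1 - e^{-2iz} = -e^{-2iz}(1 - e^{2iz}).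
The multiplier is the one of θ, so that the quotient of the two functions is elliptic. -/
lemma thetaProd_add_pi_mul {τ : ℂ} (hτ : 0 < τ.im) (z : ℂ) :
    thetaProd (z + Real.pi * τ) τ =
      -Complex.exp (-(Complex.I * Real.pi * τ)) * Complex.exp (-(2 * Complex.I * z)) *
        thetaProd z τ := by
  have hp := norm_nome_lt_one hτ
  have e2 : Complex.exp (2 * Complex.I * (z + Real.pi * τ)) =
      Complex.exp (2 * Complex.I * (Real.pi * τ)) * Complex.exp (2 * Complex.I * z) := by
    rw [← Complex.exp_add]
    ring_nf
  have e3 : Complex.exp (2 * Complex.I * (Real.pi * τ - z)) =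
      Complex.exp (2 * Complex.I * (Real.pi * τ)) * Complex.exp (-(2 * Complex.I * z)) := by
    rw [← Complex.exp_add]
    ring_nf
  have e4 : Complex.exp (2 * Complex.I * (Real.pi * τ - (z + Real.pi * τ))) =
      Complex.exp (-(2 * Complex.I * z)) := by
    congr 1
    ring
  have e5 : Complex.exp (-(Complex.I * (z + Real.pi * τ))) =
      Complex.exp (-(Complex.I * Real.pi * τ)) * Complex.exp (-(Complex.I * z)) := by
    rw [← Complex.exp_add]
    ring_nf
  have e6 : Complex.exp (-(2 * Complex.I * z)) * Complex.exp (2 * Complex.I * z) = 1 := by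
    rw [← Complex.exp_add]
    simp
  rw [thetaProd, thetaProd, e2, e4, e3, e5, qProduct_eq hp (Complex.exp (2 * Complex.I * z)),
    qProduct_eq hp (Complex.exp (-(2 * Complex.I * z)))]
  linear_combination (-Complex.exp (-(Complex.I * Real.pi * τ)) * Complex.exp (-(Complex.I * z)) *
    qProduct (Complex.exp (2 * Complex.I * (Real.pi * τ)))
      (Complex.exp (2 * Complex.I * (Real.pi * τ)) * Complex.exp (2 * Complex.I * z)) *
    qProduct (Complex.exp (2 * Complex.I * (Real.pi * τ)))
      (Complex.exp (2 * Complex.I * (Real.pi * τ)) * Complex.exp (-(2 * Complex.I * z)))) * e6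

lemma exists_lattice_of_thetaProd_eq_zero {τ : ℂ} (hτ : 0 < τ.im) {z : ℂ}
    (h : thetaProd z τ = 0) : ∃ m n : ℤ, z = m * Real.pi + n * (Real.pi * τ) := by
  have hp := norm_nome_lt_one hτ
  have key : ∀ w : ℂ, qProduct (Complex.exp (2 * Complex.I * (Real.pi * τ)))
      (Complex.exp (2 * Complex.I * w)) = 0 →
      ∃ m n : ℤ, w = m * Real.pi + n * (Real.pi * τ) := by
    intro w hw
    by_contra hcon
    refine qProduct_ne_zero hp (fun n hn => hcon ?_) hw
    rw [← Complex.exp_nat_mul, ← Complex.exp_add, Complex.exp_eq_one_iff] at hn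
    obtain ⟨k, hk⟩ := hn
    refine ⟨k, -n, ?_⟩
    have h2 : (2 * Complex.I : ℂ) ≠ 0 := by simp
    apply mul_left_cancel₀ h2
    push_cast
    linear_combination hk
  rw [thetaProd] at h
  rcases mul_eq_zero.1 ((mul_eq_zero.1 h).resolve_left (Complex.exp_ne_zero _)) with h | h
  · exact key z h
  · obtain ⟨m, n, h⟩ := key _ h
    exact ⟨-m, 1 - n, by push_cast; linear_combination -h⟩

/-- The point `z` is a simple zero of `f`. -/
def IsSimpleZero (f : ℂ → ℂ) (z : ℂ) : Prop := f z = 0 ∧ deriv f z ≠ 0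

lemma isSimpleZero_add_iff {f u : ℂ → ℂ} {ω : ℂ} (hf : Differentiable ℂ f)
    (hu : Differentiable ℂ u) (hu0 : ∀ z, u z ≠ 0) (h : ∀ z, f (z + ω) = u z * f z) (z : ℂ) :
    IsSimpleZero f (z + ω) ↔ IsSimpleZero f z := by
  have h1 : deriv f (z + ω) = deriv u z * f z + u z * deriv f z := by
    rw [← deriv_comp_add_const, funext h, deriv_fun_mul (hu z) (hf z)]
  unfold IsSimpleZero
  rw [h1, h]
  constructor
  · rintro ⟨h2, h3⟩
    have h4 := (mul_eq_zero.1 h2).resolve_left (hu0 z)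
    refine ⟨h4, fun h5 => h3 ?_⟩
    rw [h4, h5]
    ring
  · rintro ⟨h2, h3⟩
    rw [h2, mul_zero, mul_zero, zero_add]
    exact ⟨rfl, mul_ne_zero (hu0 z) h3⟩

/-- At 0 the zero comes from the single factor 1 - e^{2iz}; the quasi-periods transport its
simplicity to every lattice point. -/
lemma hasSimpleZeros_thetaProd {τ : ℂ} (hτ : 0 < τ.im) :
    HasSimpleZeros (fun z => thetaProd z τ) := by
  have hp := norm_nome_lt_one hτ
  have hd := differentiable_thetaProd hτ
  set p := Complex.exp (2 * Complex.I * (Real.pi * τ)) with hpdef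
  have h0 : thetaProd 0 τ = 0 ∧ deriv (fun z => thetaProd z τ) 0 ≠ 0 := by
    let g : ℂ → ℂ := fun z => Complex.exp (-(Complex.I * z)) *
      (qProduct p (p * Complex.exp (2 * Complex.I * z)) *
        qProduct p (Complex.exp (2 * Complex.I * (Real.pi * τ - z))))
    have hg : Differentiable ℂ g := by
      have h := differentiable_qProduct hp
      refine Differentiable.mul (by fun_prop) (Differentiable.mul ?_ ?_)
      · exact h.comp (f := fun z => p * Complex.exp (2 * Complex.I * z)) (by fun_prop)
      · exact h.comp (f := fun z => Complex.exp (2 * Complex.I * (Real.pi * τ - z))) (by fun_prop)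
    have hg0 : g 0 ≠ 0 := by
      have : ∀ n : ℕ, p ^ n * p ≠ 1 := by
        intro n h
        have := congrArg norm h
        rw [← pow_succ, norm_pow, norm_one] at this
        exact (pow_lt_one₀ (norm_nonneg _) hp (Nat.succ_ne_zero n)).ne this
      have hh := qProduct_ne_zero hp this
      simpa [g, ← hpdef] using hh
    have heq : (fun z => thetaProd z τ) = fun z => (1 - Complex.exp (2 * Complex.I * z)) * g z := by
      funext z
      rw [thetaProd, ← hpdef, qProduct_eq hp]
      ring
    refine ⟨by have := congrFun heq 0; simpa using this, ?_⟩
    have h1 : HasDerivAt (fun z => 1 - Complex.exp (2 * Complex.I * z)) (-(2 * Complex.I)) 0 := by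
      have h2 : HasDerivAt (fun z : ℂ => 2 * Complex.I * z) (2 * Complex.I) 0 := by
        simpa using (hasDerivAt_id (0 : ℂ)).const_mul (2 * Complex.I)
      simpa using h2.cexp.const_sub 1
    rw [heq, (h1.fun_mul (hg 0).hasDerivAt).deriv]
    simpa using hg0
  intro z hz
  obtain ⟨m, n, rfl⟩ := exists_lattice_of_thetaProd_eq_zero hτ hz
  have s1 : ∀ z, IsSimpleZero (fun z => thetaProd z τ) (z + Real.pi) ↔
      IsSimpleZero (fun z => thetaProd z τ) z :=
    isSimpleZero_add_iff hd (u := fun _ => -1) (by fun_prop) (by simp)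
      (fun z => by simp [thetaProd_add_pi])
  have s2 : ∀ z, IsSimpleZero (fun z => thetaProd z τ) (z + Real.pi * τ) ↔
      IsSimpleZero (fun z => thetaProd z τ) z :=
    isSimpleZero_add_iff hd
      (u := fun z => -Complex.exp (-(Complex.I * Real.pi * τ)) * Complex.exp (-(2 * Complex.I * z)))
      (by fun_prop)
      (fun z => mul_ne_zero (neg_ne_zero.2 (Complex.exp_ne_zero _)) (Complex.exp_ne_zero _))
      (thetaProd_add_pi_mul hτ)
  have p1 := Function.Periodic.int_mul (f := IsSimpleZero (fun z => thetaProd z τ))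
    (fun z => propext (s1 z)) m
  have p2 := Function.Periodic.int_mul (f := IsSimpleZero (fun z => thetaProd z τ))
    (fun z => propext (s2 z)) n
  have h3 : IsSimpleZero (fun z => thetaProd z τ) (0 + m * Real.pi + n * (Real.pi * τ)) := by
    rw [p2, p1]
    exact h0
  rw [zero_add] at h3
  exact h3.2

/-- The Jacobi triple product, up to the value of the constant. -/
lemma exists_theta_eq_mul_thetaProd {τ : ℂ} (hre : τ.re = 0) (hτ : 0 < τ.im) :
    ∃ κ : ℂ, κ ≠ 0 ∧ ∀ z, theta z τ = κ * thetaProd z τ := by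
  -- The product has only simple zeros, all of them zeros of θ, so θ is an entire multiple of it;
  -- equal multipliers make the factor elliptic, hence constant. The value at π/2 shows that the
  -- constant is not zero.
  obtain ⟨r, hr, h⟩ := exists_entire_quotient (differentiable_theta hτ) (differentiable_thetaProd hτ)
    (hasSimpleZeros_thetaProd hτ) (fun z hz => by
      obtain ⟨m, n, rfl⟩ := exists_lattice_of_thetaProd_eq_zero hτ hz
      exact theta_lattice hτ m n)
  have hne : ∃ z, thetaProd z τ ≠ 0 := by
    refine ⟨Real.pi / 2, fun h0 => theta_pi_div_two_ne_zero hre hτ ?_⟩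
    have := h (Real.pi / 2)
    simpa [h0] using this
  have hconst : ∀ z, r z = r (Real.pi / 2) := fun z => by
    refine eq_of_doublyPeriodic hτ hr ?_ ?_ z _
    · exact periodic_quotient (u := fun _ => -1) hr.continuous (differentiable_thetaProd hτ) hne
        (by simp) h (fun z => by simp [theta_add_pi]) (fun z => by simp [thetaProd_add_pi])
    · exact periodic_quotient hr.continuous (differentiable_thetaProd hτ) hne
        (u := fun z => -Complex.exp (-(Complex.I * Real.pi * τ)) * Complex.exp (-(2 * Complex.I * z)))
        (fun z => mul_ne_zero (neg_ne_zero.2 (Complex.exp_ne_zero _)) (Complex.exp_ne_zero _)) h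
        (theta_add_pi_mul hτ) (thetaProd_add_pi_mul hτ)
  refine ⟨r (Real.pi / 2), fun h0 => theta_pi_div_two_ne_zero hre hτ ?_, fun z => by
    rw [← hconst z]; exact h z⟩
  have := h (Real.pi / 2)
  simpa [h0] using this

lemma theta_eq_zero_iff {τ : ℂ} (hre : τ.re = 0) (hτ : 0 < τ.im) (z : ℂ) :
    theta z τ = 0 ↔ ∃ m n : ℤ, z = m * Real.pi + n * (Real.pi * τ) := by
  constructor
  · intro h
    obtain ⟨κ, h0, hk⟩ := exists_theta_eq_mul_thetaProd hre hτ
    rw [hk] at h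
    exact exists_lattice_of_thetaProd_eq_zero hτ ((mul_eq_zero.1 h).resolve_left h0)
  · rintro ⟨m, n, rfl⟩
    exact theta_lattice hτ m n

lemma hasSimpleZeros_theta {τ : ℂ} (hre : τ.re = 0) (hτ : 0 < τ.im) :
    HasSimpleZeros (fun z => theta z τ) := by
  intro z hz
  obtain ⟨κ, h0, hk⟩ := exists_theta_eq_mul_thetaProd hre hτ
  have hz' : theta z τ = 0 := hz
  rw [hk] at hz'
  rw [funext hk, deriv_const_mul_field]
  exact mul_ne_zero h0 (hasSimpleZeros_thetaProd hτ z ((mul_eq_zero.1 hz').resolve_left h0))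

lemma theta'_zero_ne_zero {τ : ℂ} (hre : τ.re = 0) (hτ : 0 < τ.im) : theta' 0 τ ≠ 0 :=
  hasSimpleZeros_theta hre hτ 0 (theta_zero τ)

/-- The zeros of θ lie on the horizontal lines at the integer multiples of π Im τ. -/
lemma theta_ne_zero_of_im {τ z : ℂ} (hre : τ.re = 0) (hτ : 0 < τ.im) (n : ℤ)
    (h1 : n * (Real.pi * τ.im) < z.im) (h2 : z.im < (n + 1) * (Real.pi * τ.im)) :
    theta z τ ≠ 0 := by
  intro h
  obtain ⟨m, k, rfl⟩ := (theta_eq_zero_iff hre hτ z).1 h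
  have hpos : 0 < Real.pi * τ.im := mul_pos Real.pi_pos hτ
  simp at h1 h2
  have h3 := lt_of_mul_lt_mul_right h1 hpos.le
  have h4 := lt_of_mul_lt_mul_right h2 hpos.le
  norm_cast at h3 h4
  omega

/-! ### The generating function of quadrant walks -/

/-- The walks of length `n` that stay in the quadrant. -/
def quadrantWalks (n : ℕ) : Finset (Fin n → ℤ × ℤ) :=
  {w ∈ Fintype.piFinset (fun _ : Fin n => steps) |
    ∀ k : Fin (n + 1), 0 ≤ (position w k).1 ∧ 0 ≤ (position w k).2}

/-- The weighted sum of `x^i y^j` over the walks of length `n`, where `(i, j)` is the end point. -/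
noncomputable def walkPoly (a : ℝ) (n : ℕ) (x y : ℂ) : ℂ :=
  ∑ w ∈ quadrantWalks n, ((∏ m : Fin n, stepWeight a (w m) : ℝ) : ℂ) *
    (x ^ (position w n).1.toNat * y ^ (position w n).2.toNat)

lemma walkCount_eq (a : ℝ) (i j n : ℕ) : (walkCount a i j n : ℂ) =
    ∑ w ∈ quadrantWalks n, if (position w n).1.toNat = i then if (position w n).2.toNat = j then
      ((∏ m : Fin n, stepWeight a (w m) : ℝ) : ℂ) else 0 else 0 := by
  have hw : walks i j n = (quadrantWalks n).filter
      (fun w => (position w n).1.toNat = i ∧ (position w n).2.toNat = j) := by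
    ext w
    simp only [walks, quadrantWalks, Finset.mem_filter, and_assoc]
    refine and_congr_right fun _ => and_congr_right fun h => ?_
    have h1 := h (Fin.last n)
    simp only [Fin.val_last] at h1
    rw [Prod.ext_iff]
    simp only
    omega
  rw [walkCount, hw, Finset.sum_filter]
  push_cast
  refine Finset.sum_congr rfl fun w _ => ?_
  rw [ite_and]
  split_ifs <;> simp

/-- For fixed n there are finitely many walks, so the sums over i and j have finite support and need
no convergence hypothesis on x and y. -/
lemma tsum_walkCount (a : ℝ) (n : ℕ) (x y : ℂ) (s : ℂ) :
    ∑' i : ℕ, ∑' j : ℕ, (walkCount a i j n : ℂ) * x ^ i * y ^ j * s = walkPoly a n x y * s := by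
  have hj : ∀ i : ℕ, ∑' j : ℕ, (walkCount a i j n : ℂ) * x ^ i * y ^ j * s =
      ∑ w ∈ quadrantWalks n, if i = (position w n).1.toNat then
        ((∏ m : Fin n, stepWeight a (w m) : ℝ) : ℂ) *
          (x ^ i * y ^ (position w n).2.toNat) * s else 0 := by
    intro i
    have : ∀ j : ℕ, (walkCount a i j n : ℂ) * x ^ i * y ^ j * s =
        ∑ w ∈ quadrantWalks n, if j = (position w n).2.toNat then
          (if i = (position w n).1.toNat then ((∏ m : Fin n, stepWeight a (w m) : ℝ) : ℂ) *
          (x ^ i * y ^ (position w n).2.toNat) * s else 0) else 0 := by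
      intro j
      rw [walkCount_eq, Finset.sum_mul, Finset.sum_mul, Finset.sum_mul]
      refine Finset.sum_congr rfl fun w _ => ?_
      by_cases h1 : (position w n).1.toNat = i
      · by_cases h2 : (position w n).2.toNat = j
        · simp only [h1, h2, if_true]; ring
        · simp [h2, Ne.symm h2]
      · simp [h1, Ne.symm h1]
    rw [tsum_congr this, Summable.tsum_finsetSum fun w _ => (hasSum_ite_eq _ _).summable]
    exact Finset.sum_congr rfl fun w _ => tsum_ite_eq _ _
  rw [tsum_congr hj, Summable.tsum_finsetSum fun w _ => ?_, walkPoly, Finset.sum_mul]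
  · refine Finset.sum_congr rfl fun w _ => ?_
    rw [tsum_eq_single (position w n).1.toNat (fun i hi => if_neg hi), if_pos rfl]
  · exact summable_of_ne_finset_zero (s := {(position w n).1.toNat})
      fun i hi => if_neg (by simpa using hi)

lemma Q_eq_tsum (a t : ℝ) (x y : ℂ) :
    Q a t x y = ∑' n : ℕ, walkPoly a n x y * (t : ℂ) ^ n := by
  rw [Q]
  exact tsum_congr fun n => tsum_walkCount a n x y _

lemma position_snoc_of_le {n : ℕ} (w : Fin n → ℤ × ℤ) (s : ℤ × ℤ) {k : ℕ} (hk : k ≤ n) :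
    position (Fin.snoc w s : Fin (n + 1) → ℤ × ℤ) k = position w k := by
  rw [position, position, Finset.sum_filter, Finset.sum_filter, Fin.sum_univ_castSucc]
  simp [hk.not_gt]

lemma position_snoc_last {n : ℕ} (w : Fin n → ℤ × ℤ) (s : ℤ × ℤ) :
    position (Fin.snoc w s : Fin (n + 1) → ℤ × ℤ) (n + 1) = position w n + s := by
  rw [position, position, Finset.sum_filter, Finset.sum_filter, Fin.sum_univ_castSucc]
  congr 1
  · refine Finset.sum_congr rfl fun i _ => ?_
    simp [i.isLt, Nat.lt_succ_of_lt i.isLt]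
  · simp

lemma snoc_mem_quadrantWalks {n : ℕ} (w : Fin n → ℤ × ℤ) (s : ℤ × ℤ) :
    (Fin.snoc w s : Fin (n + 1) → ℤ × ℤ) ∈ quadrantWalks (n + 1) ↔ w ∈ quadrantWalks n ∧
      s ∈ steps ∧ 0 ≤ (position w n + s).1 ∧ 0 ≤ (position w n + s).2 := by
  have hp : ∀ k : Fin (n + 1), position (Fin.snoc w s : Fin (n + 1) → ℤ × ℤ) k = position w k :=
    fun k => position_snoc_of_le w s (Nat.lt_succ_iff.1 k.isLt)
  simp only [quadrantWalks, Finset.mem_filter, Fintype.mem_piFinset]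
  rw [Fin.forall_fin_succ', Fin.forall_fin_succ' (n := n + 1)]
  simp only [Fin.snoc_castSucc, Fin.snoc_last, Fin.val_castSucc, Fin.val_last, hp,
    position_snoc_last]
  tauto

lemma sum_quadrantWalks_succ {n : ℕ} (f : (Fin (n + 1) → ℤ × ℤ) → ℂ) :
    ∑ w ∈ quadrantWalks (n + 1), f w = ∑ w ∈ quadrantWalks n, ∑ s ∈ steps,
      if 0 ≤ (position w n + s).1 ∧ 0 ≤ (position w n + s).2 then f (Fin.snoc w s) else 0 := by
  rw [← Finset.sum_product', ← Finset.sum_filter]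
  refine Finset.sum_bij' (fun w _ => (Fin.init w, w (Fin.last n))) (fun p _ => Fin.snoc p.1 p.2)
    ?_ ?_ ?_ ?_ ?_
  · intro w hw
    rw [← Fin.snoc_init_self w, snoc_mem_quadrantWalks] at hw
    simp only [Finset.mem_filter, Finset.mem_product]
    tauto
  · intro p hp
    simp only [Finset.mem_filter, Finset.mem_product] at hp
    rw [snoc_mem_quadrantWalks]
    tauto
  · intro w _
    exact Fin.snoc_init_self w
  · intro p _
    simp
  · intro w _
    simp

lemma walkPoly_zero (a : ℝ) (x y : ℂ) : walkPoly a 0 x y = 1 := by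
  have : quadrantWalks 0 = Finset.univ := by
    ext w
    simp [quadrantWalks, position]
  simp [walkPoly, this, position]

lemma sum_steps (f : ℤ × ℤ → ℂ) : ∑ s ∈ steps, f s =
    f (0, 1) + f (1, 0) + f (0, -1) + f (-1, 0) + f (1, 1) := by
  rw [steps, Finset.sum_insert (by decide), Finset.sum_insert (by decide),
    Finset.sum_insert (by decide), Finset.sum_insert (by decide), Finset.sum_singleton]
  ring

/-- A last step is appended. The subtracted terms are the west steps from i = 0 and the south steps
from j = 0, which would leave the quadrant; putting a variable equal to 0 selects these walks,
because 0 ^ 0 = 1. -/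
lemma walkPoly_succ (a : ℝ) (n : ℕ) {x y : ℂ} (hx : x ≠ 0) (hy : y ≠ 0) :
    walkPoly a (n + 1) x y = (x + y + 1 / x + 1 / y + a * x * y) * walkPoly a n x y -
      walkPoly a n 0 y / x - walkPoly a n x 0 / y := by
  rw [walkPoly, sum_quadrantWalks_succ, walkPoly, walkPoly, walkPoly, Finset.mul_sum,
    Finset.sum_div, Finset.sum_div, ← Finset.sum_sub_distrib, ← Finset.sum_sub_distrib]
  refine Finset.sum_congr rfl fun w hw => ?_
  have hpos := (Finset.mem_filter.1 hw).2 (Fin.last n)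
  simp only [Fin.val_last] at hpos
  obtain ⟨i, hi⟩ := Int.eq_ofNat_of_zero_le hpos.1
  obtain ⟨j, hj⟩ := Int.eq_ofNat_of_zero_le hpos.2
  have hP : position w n = ((i : ℤ), (j : ℤ)) := Prod.ext hi hj
  set W : ℂ := ((∏ m : Fin n, stepWeight a (w m) : ℝ) : ℂ) with hW
  have hterm : ∀ s : ℤ × ℤ, ((∏ m : Fin (n + 1), stepWeight a
      ((Fin.snoc w s : Fin (n + 1) → ℤ × ℤ) m) : ℝ) : ℂ) = W * (stepWeight a s : ℂ) := by
    intro s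
    rw [Fin.prod_univ_castSucc, hW]
    simp
  simp only [hterm]
  simp only [position_snoc_last, hP, sum_steps, stepWeight, Prod.mk_add_mk, Int.toNat_natCast]
  have t1 : ((i : ℤ) + 1).toNat = i + 1 := by omega
  have t2 : ((j : ℤ) + 1).toNat = j + 1 := by omega
  have p1 : (0 : ℤ) ≤ i := by omega
  have p2 : (0 : ℤ) ≤ j := by omega
  have p3 : (0 : ℤ) ≤ (i : ℤ) + 1 := by omega
  have p4 : (0 : ℤ) ≤ (j : ℤ) + 1 := by omega
  simp only [add_zero, t1, t2, p1, p2, p3, p4, Int.toNat_natCast, true_and, and_true, if_true]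
  rcases i with _ | i <;> rcases j with _ | j <;> simp <;> field_simp <;> ring

lemma sum_steps_weight (a : ℝ) : ∑ s ∈ steps, stepWeight a s = a + 4 := by
  rw [steps, Finset.sum_insert (by decide), Finset.sum_insert (by decide),
    Finset.sum_insert (by decide), Finset.sum_insert (by decide), Finset.sum_singleton]
  simp [stepWeight]
  ring

lemma stepWeight_nonneg {a : ℝ} (ha : 0 < a) (s : ℤ × ℤ) : 0 ≤ stepWeight a s := by
  unfold stepWeight
  split_ifs <;> positivity

/-- Without the quadrant constraint the walks of length n have total weight (a + 4)^n. This is where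
the bound t < 1/(a + 4) comes from: it gives convergence on the closed bidisk. -/
lemma norm_walkPoly_le {a : ℝ} (ha : 0 < a) (n : ℕ) {x y : ℂ} (hx : ‖x‖ ≤ 1) (hy : ‖y‖ ≤ 1) :
    ‖walkPoly a n x y‖ ≤ (a + 4) ^ n := by
  have h0 : ∀ w : Fin n → ℤ × ℤ, 0 ≤ ∏ m, stepWeight a (w m) := fun w =>
    Finset.prod_nonneg fun m _ => stepWeight_nonneg ha _
  calc ‖walkPoly a n x y‖ ≤ ∑ w ∈ quadrantWalks n, ∏ m, stepWeight a (w m) := by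
        refine norm_sum_le_of_le _ fun w _ => ?_
        rw [norm_mul, Complex.norm_real, Real.norm_of_nonneg (h0 w), norm_mul, norm_pow, norm_pow]
        refine mul_le_of_le_one_right (h0 w) ?_
        exact mul_le_one₀ (pow_le_one₀ (norm_nonneg _) hx) (by positivity)
          (pow_le_one₀ (norm_nonneg _) hy)
    _ ≤ ∑ w ∈ Fintype.piFinset (fun _ : Fin n => steps), ∏ m, stepWeight a (w m) :=
        Finset.sum_le_sum_of_subset_of_nonneg (Finset.filter_subset _ _) fun w _ _ => h0 w
    _ = (a + 4) ^ n := by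
        rw [← Finset.prod_univ_sum]
        simp [sum_steps_weight]

lemma walkPoly_swap (a : ℝ) (n : ℕ) (x y : ℂ) : walkPoly a n x y = walkPoly a n y x := by
  have hpos : ∀ (w : Fin n → ℤ × ℤ) (k : ℕ),
      position (fun m => (w m).swap) k = (position w k).swap := by
    intro w k
    rw [position, position]
    apply Prod.ext <;> simp [Prod.fst_sum, Prod.snd_sum]
  have hst : ∀ s : ℤ × ℤ, s.swap ∈ steps ↔ s ∈ steps := by
    rintro ⟨s1, s2⟩
    simp only [steps, Finset.mem_insert, Finset.mem_singleton, Prod.swap_prod_mk, Prod.mk.injEq]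
    omega
  have hmem : ∀ w : Fin n → ℤ × ℤ, (fun m => (w m).swap) ∈ quadrantWalks n ↔
      w ∈ quadrantWalks n := by
    intro w
    simp only [quadrantWalks, Finset.mem_filter, Fintype.mem_piFinset, hst, hpos, Prod.fst_swap,
      Prod.snd_swap, and_comm]
  have hwt : ∀ s : ℤ × ℤ, stepWeight a s.swap = stepWeight a s := by
    rintro ⟨s1, s2⟩
    simp only [stepWeight, Prod.swap_prod_mk, Prod.mk.injEq, and_comm]
  rw [walkPoly, walkPoly]
  refine Finset.sum_bij' (fun w _ m => (w m).swap) (fun w _ m => (w m).swap) (fun w hw => (hmem w).2 hw)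
    (fun w hw => (hmem w).2 hw) (fun w _ => by simp) (fun w _ => by simp) fun w _ => ?_
  rw [hpos]
  simp only [hwt, Prod.fst_swap, Prod.snd_swap]
  ring

lemma Q_swap (a t : ℝ) (x y : ℂ) : Q a t x y = Q a t y x := by
  rw [Q_eq_tsum, Q_eq_tsum]
  exact tsum_congr fun n => by rw [walkPoly_swap]

lemma summable_bound {a t : ℝ} (ha : 0 < a) (ht : 0 < t) (hta : t < 1 / (a + 4))
    : Summable fun n : ℕ => ((a + 4) * t) ^ n := by
  refine summable_geometric_of_lt_one (by positivity) ?_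
  rw [lt_div_iff₀ (by positivity)] at hta
  linarith

lemma norm_walkPoly_mul_le {a t : ℝ} (ha : 0 < a) (ht : 0 < t) (n : ℕ) {x y : ℂ} (hx : ‖x‖ ≤ 1) (hy : ‖y‖ ≤ 1) :
    ‖walkPoly a n x y * (t : ℂ) ^ n‖ ≤ ((a + 4) * t) ^ n := by
  rw [norm_mul, norm_pow, Complex.norm_real, Real.norm_of_nonneg ht.le, mul_pow]
  exact mul_le_mul_of_nonneg_right (norm_walkPoly_le ha n hx hy) (by positivity)

lemma summable_walkPoly {a t : ℝ} (ha : 0 < a) (ht : 0 < t) (hta : t < 1 / (a + 4))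
    {x y : ℂ} (hx : ‖x‖ ≤ 1) (hy : ‖y‖ ≤ 1) :
    Summable fun n : ℕ => walkPoly a n x y * (t : ℂ) ^ n :=
  Summable.of_norm_bounded (summable_bound ha ht hta) fun n =>
    norm_walkPoly_mul_le ha ht n hx hy

/-- The functional equation of the generating function. -/
lemma Q_functional_equation {a t : ℝ} (ha : 0 < a) (ht : 0 < t) (hta : t < 1 / (a + 4))
    {x y : ℂ} (hx : ‖x‖ ≤ 1) (hy : ‖y‖ ≤ 1) (hx0 : x ≠ 0) (hy0 : y ≠ 0) :
    Q a t x y = 1 + t * (x + y + 1 / x + 1 / y + a * x * y) * Q a t x y -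
      t / x * Q a t 0 y - t / y * Q a t x 0 := by
  have s1 := (summable_walkPoly ha ht hta hx hy).hasSum
  have s2 := (summable_walkPoly ha ht hta (x := 0) (by simp) hy).hasSum
  have s3 := (summable_walkPoly ha ht hta (y := 0) hx (by simp)).hasSum
  rw [← Q_eq_tsum] at s1 s2 s3
  have s4 := ((s1.mul_left (t * (x + y + 1 / x + 1 / y + a * x * y))).sub
    (s2.mul_left (t / x : ℂ))).sub (s3.mul_left (t / y : ℂ))
  have s5 : HasSum (fun n : ℕ => walkPoly a (n + 1) x y * (t : ℂ) ^ (n + 1))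
      (t * (x + y + 1 / x + 1 / y + a * x * y) * Q a t x y -
      t / x * Q a t 0 y - t / y * Q a t x 0) := by
    refine s4.congr_fun fun n => ?_
    rw [walkPoly_succ a n hx0 hy0, pow_succ]
    ring
  have s6 := (hasSum_nat_add_iff (f := fun n : ℕ => walkPoly a n x y * (t : ℂ) ^ n) 1).1 s5
  have := s1.unique s6
  rw [Finset.sum_range_one, walkPoly_zero] at this
  linear_combination this

/-- On the zero set of the kernel. -/
lemma Q_kernel {a t : ℝ} (ha : 0 < a) (ht : 0 < t) (hta : t < 1 / (a + 4))
    {x y : ℂ} (hx : ‖x‖ ≤ 1) (hy : ‖y‖ ≤ 1) (hx0 : x ≠ 0) (hy0 : y ≠ 0)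
    (hk : 1 / (t : ℂ) = x + y + 1 / x + 1 / y + a * x * y) :
    t * x * Q a t x 0 + t * y * Q a t 0 y = x * y := by
  have ht0 : (t : ℂ) ≠ 0 := by exact_mod_cast ht.ne'
  have h := Q_functional_equation ha ht hta hx hy hx0 hy0
  -- The coefficient of Q(x, y) on the right becomes t · (1/t) = 1, so Q(x, y), which is finite
  -- here, cancels.
  rw [← hk] at h
  field_simp at h
  linear_combination h

lemma differentiableOn_Q {a t : ℝ} (ha : 0 < a) (ht : 0 < t) (hta : t < 1 / (a + 4))
    : DifferentiableOn ℂ (fun x => Q a t x 0) (Metric.ball 0 1) := by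
  simp_rw [Q_eq_tsum]
  refine Complex.differentiableOn_tsum_of_summable_norm (summable_bound ha ht hta) (fun n => ?_)
    Metric.isOpen_ball fun n x hx => norm_walkPoly_mul_le ha ht n ?_ (by simp)
  · unfold walkPoly
    fun_prop
  · simpa using (mem_ball_zero_iff.1 hx).le

/-! ### Uniformization of the kernel -/

/-- At a zero `z` of `θ`, the translate `θ(z + w)` is an exponential multiple of `θ(w)`. -/
lemma exists_theta_add_of_eq_zero {τ : ℂ} (hre : τ.re = 0) (hτ : 0 < τ.im) {z : ℂ}
    (hz : theta z τ = 0) : ∃ κ l : ℂ, κ ≠ 0 ∧ ∀ w, theta (z + w) τ =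
      κ * Complex.exp (l * w) * theta w τ := by
  obtain ⟨m, n, rfl⟩ := (theta_eq_zero_iff hre hτ z).1 hz
  obtain ⟨κ, h0, h⟩ := exists_theta_add_lattice hτ m n
  exact ⟨κ, _, h0, fun w => by rw [add_comm, h w]⟩

lemma theta_add_ne_zero {τ z w : ℂ} (hre : τ.re = 0) (hτ : 0 < τ.im)
    (hz : theta z τ = 0) (hw : theta w τ ≠ 0) : theta (z + w) τ ≠ 0 := by
  obtain ⟨κ, l, h0, h⟩ := exists_theta_add_of_eq_zero hre hτ hz
  rw [h]
  exact mul_ne_zero (mul_ne_zero h0 (Complex.exp_ne_zero _)) hw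

lemma theta'_neg (z τ : ℂ) : theta' (-z) τ = theta' z τ := by
  have h : (fun w => theta (-w) τ) = fun w => -theta w τ := funext fun w => theta_neg w τ
  have h1 := congrArg (fun f => deriv f z) h
  have h2 := deriv_comp_neg (fun w => theta w τ) z
  simp only [deriv.fun_neg] at h1
  rw [theta', theta']
  linear_combination h2 - h1

lemma Y_eq_X_neg (c γ τ z : ℂ) : Y c γ τ z = X c γ τ (-z) := by
  rw [X, Y, show -z + γ = -(z - γ) by ring, show -z - γ = -(z + γ) by ring,
    show -z + 2 * γ = -(z - 2 * γ) by ring]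
  simp only [theta_neg, neg_mul_neg]

/-- The reflection exchanges the zeros 0 and -γ, and the poles γ and -2γ. -/
lemma X_symm (c γ τ z : ℂ) : X c γ τ (-γ - z) = X c γ τ z := by
  rw [X, X, show -γ - z = -(z + γ) by ring, show -(z + γ) + γ = -z by ring,
    show -(z + γ) - γ = -(z + 2 * γ) by ring, show -(z + γ) + 2 * γ = -(z - γ) by ring]
  simp only [theta_neg, neg_mul_neg]
  rw [mul_comm (theta (z + γ) τ), mul_comm (theta (z + 2 * γ) τ)]

lemma X_add_pi (c γ τ z : ℂ) : X c γ τ (z + Real.pi) = X c γ τ z := by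
  rw [X, X, show z + Real.pi + γ = (z + γ) + Real.pi by ring,
    show z + Real.pi - γ = (z - γ) + Real.pi by ring,
    show z + Real.pi + 2 * γ = (z + 2 * γ) + Real.pi by ring]
  simp only [theta_add_pi, neg_mul_neg]

/-- The zeros 0, -γ and the poles γ, -2γ have the same sum, so the multipliers cancel. -/
lemma X_add_pi_mul {c γ τ : ℂ} (hτ : 0 < τ.im) (z : ℂ) :
    X c γ τ (z + Real.pi * τ) = X c γ τ z := by
  rw [X, X, show z + Real.pi * τ + γ = (z + γ) + Real.pi * τ by ring,
    show z + Real.pi * τ - γ = (z - γ) + Real.pi * τ by ring,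
    show z + Real.pi * τ + 2 * γ = (z + 2 * γ) + Real.pi * τ by ring]
  simp only [theta_add_pi_mul hτ]
  have e : Complex.exp (-(2 * Complex.I * z)) * Complex.exp (-(2 * Complex.I * (z + γ))) =
      Complex.exp (-(2 * Complex.I * (z - γ))) * Complex.exp (-(2 * Complex.I * (z + 2 * γ))) := by
    rw [← Complex.exp_add, ← Complex.exp_add]
    ring_nf
  congr 1
  set p := -Complex.exp (-(Complex.I * Real.pi * τ)) with hp
  have hp0 : p ≠ 0 := neg_ne_zero.2 (Complex.exp_ne_zero _)
  have hu := mul_ne_zero (mul_ne_zero hp0 hp0) (mul_ne_zero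
    (Complex.exp_ne_zero (-(2 * Complex.I * (z - γ))))
    (Complex.exp_ne_zero (-(2 * Complex.I * (z + 2 * γ)))))
  rw [← mul_div_mul_left (theta z τ * theta (z + γ) τ) _ hu]
  congr 1
  · linear_combination (p * p * theta z τ * theta (z + γ) τ) * e
  · ring

namespace IsUniformizingTriple

variable {a t : ℝ} {c γ τ : ℂ}

lemma gamma_im_pos (h : IsUniformizingTriple a t c γ τ) : 0 < γ.im := by
  have := h.gamma_pos
  simp at this
  linarith

lemma two_gamma_im_lt (h : IsUniformizingTriple a t c γ τ) : 2 * γ.im < Real.pi * τ.im := by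
  simpa using h.gamma_lt

lemma tau_im_pos (h : IsUniformizingTriple a t c γ τ) : 0 < τ.im := by
  have h1 := h.gamma_im_pos
  have h2 := h.two_gamma_im_lt
  have h3 : 0 < Real.pi * τ.im := by linarith
  exact pos_of_mul_pos_right h3 Real.pi_pos.le

lemma theta_gamma_ne_zero (h : IsUniformizingTriple a t c γ τ) : theta γ τ ≠ 0 :=
  theta_ne_zero_of_im h.tau_re h.tau_im_pos 0 (by simpa using h.gamma_im_pos)
    (by have := h.gamma_im_pos; have := h.two_gamma_im_lt; simp; linarith)

lemma theta_two_gamma_ne_zero (h : IsUniformizingTriple a t c γ τ) : theta (2 * γ) τ ≠ 0 :=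
  theta_ne_zero_of_im h.tau_re h.tau_im_pos 0 (by simpa using h.gamma_im_pos)
    (by have := h.two_gamma_im_lt; simp; linarith)

lemma mul_theta_gamma (h : IsUniformizingTriple a t c γ τ) :
    c ^ 2 * theta γ τ = theta (3 * γ) τ := by
  rw [h.eq_c2, div_mul_cancel₀ _ h.theta_gamma_ne_zero]

lemma mul_theta_two_gamma (h : IsUniformizingTriple a t c γ τ) :
    a * c ^ 3 * theta (2 * γ) τ = -theta (4 * γ) τ := by
  rw [h.eq_ac3, neg_mul, div_mul_cancel₀ _ h.theta_two_gamma_ne_zero]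

/-- If c = 0, both 3γ and 4γ are zeros of θ; but a translate of the non-zero γ by a zero of θ is not
a zero. -/
lemma c_ne_zero (h : IsUniformizingTriple a t c γ τ) : c ≠ 0 := by
  intro hc
  have h3 := h.mul_theta_gamma
  have h4 := h.mul_theta_two_gamma
  rw [hc] at h3 h4
  have h3' : theta (3 * γ) τ = 0 := by rw [← h3]; ring
  have h4' : theta (4 * γ) τ = 0 := by
    rw [← neg_eq_zero, ← h4]
    ring
  have := theta_add_ne_zero h.tau_re h.tau_im_pos h3' h.theta_gamma_ne_zero
  exact this (by rw [← h4']; ring_nf)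

lemma theta_three_gamma_ne_zero (h : IsUniformizingTriple a t c γ τ) : theta (3 * γ) τ ≠ 0 := by
  rw [← h.mul_theta_gamma]
  exact mul_ne_zero (pow_ne_zero _ h.c_ne_zero) h.theta_gamma_ne_zero

lemma theta_four_gamma_ne_zero (h : IsUniformizingTriple a t c γ τ) (ha : 0 < a) :
    theta (4 * γ) τ ≠ 0 := by
  rw [← neg_ne_zero, ← h.mul_theta_two_gamma]
  exact mul_ne_zero (mul_ne_zero (by exact_mod_cast ha.ne') (pow_ne_zero _ h.c_ne_zero))
    h.theta_two_gamma_ne_zero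

lemma conj_gamma (h : IsUniformizingTriple a t c γ τ) : (starRingEnd ℂ) γ = -γ := by
  apply Complex.ext <;> simp [h.gamma_re]

/-- θ is real at real multiples of γ, so c² and ac³ are real, and c is determined by their quotient.
-/
lemma conj_c (h : IsUniformizingTriple a t c γ τ) (ha : 0 < a) : (starRingEnd ℂ) c = c := by
  have hreal : ∀ k : ℝ, (starRingEnd ℂ) (theta (k * γ) τ) = theta (k * γ) τ := by
    intro k
    rw [theta_conj h.tau_re, map_mul, h.conj_gamma, Complex.conj_ofReal, mul_neg, theta_neg, neg_neg]
  have r1 := hreal 1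
  have r2 := hreal 2
  have r3 := hreal 3
  have r4 := hreal 4
  norm_num at r1 r2 r3 r4
  have h2 : (starRingEnd ℂ) (c ^ 2) = c ^ 2 := by
    rw [h.eq_c2, map_div₀, r1, r3]
  have h3 : (starRingEnd ℂ) (a * c ^ 3) = a * c ^ 3 := by
    rw [h.eq_ac3, map_neg, map_div₀, r2, r4]
  have ha' : (a : ℂ) ≠ 0 := by exact_mod_cast ha.ne'
  rw [map_mul, Complex.conj_ofReal, pow_succ, map_mul, h2] at h3
  exact mul_left_cancel₀ (mul_ne_zero ha' (pow_ne_zero 2 h.c_ne_zero)) (by linear_combination h3)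

lemma mul_theta' (h : IsUniformizingTriple a t c γ τ) :
    c / t * theta' 0 τ * theta γ τ =
      4 * theta' γ τ * theta (2 * γ) τ - 2 * theta' (2 * γ) τ * theta γ τ := by
  have h0 := theta'_zero_ne_zero h.tau_re h.tau_im_pos
  have h1 := h.theta_gamma_ne_zero
  rw [h.eq_c_on_t]
  field_simp

end IsUniformizingTriple

/-! ### The kernel equation as an identity between theta functions. -/

/-- The kernel, cleared of denominators, in terms of theta functions. -/
noncomputable def kernelNumerator (a t : ℝ) (c γ τ z : ℂ) : ℂ :=
  c ^ 2 * (theta z τ ^ 2 * theta (z + γ) τ ^ 2 * theta (z + -(2 * γ)) τ) +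
  c ^ 2 * (theta z τ ^ 2 * theta (z + -γ) τ ^ 2 * theta (z + 2 * γ) τ) +
  theta (z + -γ) τ ^ 2 * theta (z + 2 * γ) τ ^ 2 * theta (z + -(2 * γ)) τ +
  theta (z + γ) τ ^ 2 * theta (z + -(2 * γ)) τ ^ 2 * theta (z + 2 * γ) τ +
  a * c ^ 3 * (theta z τ ^ 3 * theta (z + γ) τ * theta (z + -γ) τ) -
  c / t * (theta z τ * theta (z + γ) τ * theta (z + -γ) τ * theta (z + 2 * γ) τ *
    theta (z + -(2 * γ)) τ)

/-- The common denominator of the kernel. -/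
noncomputable def kernelDenominator (γ τ z : ℂ) : ℂ :=
  theta z τ * theta (z + γ) τ * theta (z + -γ) τ * theta (z + 2 * γ) τ * theta (z + -(2 * γ)) τ

lemma differentiable_theta_add {τ : ℂ} (hτ : 0 < τ.im) (s : ℂ) :
    Differentiable ℂ (fun z => theta (z + s) τ) :=
  (differentiable_theta hτ).comp (f := fun z : ℂ => z + s) (by fun_prop)

lemma differentiable_kernelNumerator {a t : ℝ} {c γ τ : ℂ} (hτ : 0 < τ.im) :
    Differentiable ℂ (kernelNumerator a t c γ τ) := by
  have h0 := differentiable_theta hτ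
  have h1 := differentiable_theta_add hτ
  have := h1 γ
  have := h1 (-γ)
  have := h1 (2 * γ)
  have := h1 (-(2 * γ))
  unfold kernelNumerator
  fun_prop

lemma differentiable_kernelDenominator {γ τ : ℂ} (hτ : 0 < τ.im) :
    Differentiable ℂ (kernelDenominator γ τ) := by
  have h0 := differentiable_theta hτ
  have h1 := differentiable_theta_add hτ
  have := h1 γ
  have := h1 (-γ)
  have := h1 (2 * γ)
  have := h1 (-(2 * γ))
  unfold kernelDenominator
  fun_prop

lemma kernel_add_pi {a t : ℝ} {c γ τ : ℂ} (z : ℂ) :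
    kernelNumerator a t c γ τ (z + Real.pi) = -1 * kernelNumerator a t c γ τ z ∧
    kernelDenominator γ τ (z + Real.pi) = -1 * kernelDenominator γ τ z := by
  have e : ∀ s, theta (z + Real.pi + s) τ = -theta (z + s) τ := fun s => by
    rw [← theta_add_pi, add_right_comm]
  simp only [kernelNumerator, kernelDenominator, e, theta_add_pi]
  constructor <;> ring

/-- Every term is a product of five theta factors whose shifts add up to zero, so the powers of `v`
cancel and the common multiplier is `μ ^ 5`. -/
lemma kernel_add_pi_mul {a t : ℝ} {c γ τ : ℂ} (hτ : 0 < τ.im) (z : ℂ) :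
    kernelNumerator a t c γ τ (z + Real.pi * τ) =
      (-Complex.exp (-(Complex.I * Real.pi * τ)) * Complex.exp (-(2 * Complex.I * z))) ^ 5 *
        kernelNumerator a t c γ τ z ∧
    kernelDenominator γ τ (z + Real.pi * τ) =
      (-Complex.exp (-(Complex.I * Real.pi * τ)) * Complex.exp (-(2 * Complex.I * z))) ^ 5 *
        kernelDenominator γ τ z := by
  set μ := -Complex.exp (-(Complex.I * Real.pi * τ)) * Complex.exp (-(2 * Complex.I * z)) with hμ
  set v := Complex.exp (-(2 * Complex.I * γ)) with hv
  have hv0 : v ≠ 0 := Complex.exp_ne_zero _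
  have e : ∀ k : ℤ, theta (z + Real.pi * τ + k * γ) τ = μ * v ^ k * theta (z + k * γ) τ := by
    intro k
    have e' : Complex.exp (-(2 * Complex.I * (z + k * γ))) =
        Complex.exp (-(2 * Complex.I * z)) * Complex.exp (k * -(2 * Complex.I * γ)) := by
      rw [← Complex.exp_add]
      ring_nf
    rw [add_right_comm, theta_add_pi_mul hτ, hμ, hv, ← Complex.exp_int_mul, e']
    ring
  have e0 := e 0
  have e1 := e 1
  have e2 := e (-1)
  have e3 := e 2
  have e4 := e (-2)
  norm_num at e0 e1 e2 e3 e4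
  simp only [← sub_eq_add_neg] at e2 e4
  simp only [kernelNumerator, kernelDenominator, ← sub_eq_add_neg, e0, e1, e2, e3, e4]
  norm_cast
  constructor <;> field_simp

/-- At a zero of any of the five factors exactly two terms of the numerator lack that factor. They
cancel by oddness of θ when θ(z) = 0, by c²θ(γ) = θ(3γ) when θ(z ± γ) = 0, and by this together with
ac³θ(2γ) = -θ(4γ) when θ(z ± 2γ) = 0. -/
lemma kernelNumerator_eq_zero_of_kernelDenominator {a t : ℝ} {c γ τ : ℂ}
    (h : IsUniformizingTriple a t c γ τ) {z : ℂ} (hz : kernelDenominator γ τ z = 0) :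
    kernelNumerator a t c γ τ z = 0 := by
  have key : ∀ z₀, theta z₀ τ = 0 → ∃ κ e : ℂ, e ≠ 0 ∧ ∀ k : ℤ,
      theta (z₀ + k * γ) τ = κ * e ^ k * theta (k * γ) τ := by
    intro z₀ hz₀
    obtain ⟨κ, l, -, hκ⟩ := exists_theta_add_of_eq_zero h.tau_re h.tau_im_pos hz₀
    refine ⟨κ, Complex.exp (l * γ), Complex.exp_ne_zero _, fun k => ?_⟩
    rw [hκ, ← Complex.exp_int_mul]
    ring_nf
  have m1 := h.mul_theta_gamma
  have m2 := h.mul_theta_two_gamma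
  have n1 : theta (-γ) τ = -theta γ τ := theta_neg _ _
  have n2 : theta (-(2 * γ)) τ = -theta (2 * γ) τ := theta_neg _ _
  have n3 : theta (-(3 * γ)) τ = -theta (3 * γ) τ := theta_neg _ _
  have n4 : theta (-(4 * γ)) τ = -theta (4 * γ) τ := theta_neg _ _
  simp only [kernelDenominator, mul_eq_zero] at hz
  rw [kernelNumerator]
  rcases hz with (((hz | hz) | hz) | hz) | hz
  · obtain ⟨κ, e, he, hk⟩ := key z hz
    have k1 := hk 1
    have k2 := hk (-1)
    have k3 := hk 2
    have k4 := hk (-2)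
    push_cast [neg_mul, one_mul] at k1 k2 k3 k4
    rw [hz, k1, k2, k3, k4, n1, n2]
    simp only [zpow_neg, zpow_ofNat]
    field_simp
    ring
  · obtain ⟨κ, e, he, hk⟩ := key (z + γ) hz
    have k1 := hk (-1)
    have k2 := hk (-2)
    have k3 := hk 1
    have k4 := hk (-3)
    push_cast [neg_mul, one_mul] at k1 k2 k3 k4
    rw [show z + γ + -γ = z by ring] at k1
    rw [show z + γ + -(2 * γ) = z + -γ by ring] at k2
    rw [show z + γ + γ = z + 2 * γ by ring] at k3
    rw [show z + γ + -(3 * γ) = z + -(2 * γ) by ring] at k4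
    rw [hz, k1, k2, k3, k4, n1, n2, n3, ← m1]
    simp only [zpow_neg, zpow_ofNat]
    field_simp
    ring
  · obtain ⟨κ, e, he, hk⟩ := key (z + -γ) hz
    have k1 := hk 1
    have k2 := hk 2
    have k3 := hk (-1)
    have k4 := hk 3
    push_cast [neg_mul, one_mul] at k1 k2 k3 k4
    rw [show z + -γ + γ = z by ring] at k1
    rw [show z + -γ + 2 * γ = z + γ by ring] at k2
    rw [show z + -γ + -γ = z + -(2 * γ) by ring] at k3
    rw [show z + -γ + 3 * γ = z + 2 * γ by ring] at k4
    rw [hz, k1, k2, k3, k4, n1, ← m1]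
    simp only [zpow_neg, zpow_ofNat]
    field_simp
    ring
  · obtain ⟨κ, e, he, hk⟩ := key (z + 2 * γ) hz
    have k1 := hk (-1)
    have k2 := hk (-2)
    have k3 := hk (-3)
    have k4 := hk (-4)
    push_cast [neg_mul, one_mul] at k1 k2 k3 k4
    rw [show z + 2 * γ + -γ = z + γ by ring] at k1
    rw [show z + 2 * γ + -(2 * γ) = z by ring] at k2
    rw [show z + 2 * γ + -(3 * γ) = z + -γ by ring] at k3
    rw [show z + 2 * γ + -(4 * γ) = z + -(2 * γ) by ring] at k4
    rw [hz, k1, k2, k3, k4, n1, n2, n3, n4, ← m1, ← m2]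
    simp only [zpow_neg, zpow_ofNat]
    field_simp
    ring
  · obtain ⟨κ, e, he, hk⟩ := key (z + -(2 * γ)) hz
    have k1 := hk 1
    have k2 := hk 2
    have k3 := hk 3
    have k4 := hk 4
    push_cast [neg_mul, one_mul] at k1 k2 k3 k4
    rw [show z + -(2 * γ) + γ = z + -γ by ring] at k1
    rw [show z + -(2 * γ) + 2 * γ = z by ring] at k2
    rw [show z + -(2 * γ) + 3 * γ = z + γ by ring] at k3
    rw [show z + -(2 * γ) + 4 * γ = z + 2 * γ by ring] at k4
    have m3 : theta (4 * γ) τ = -(a * c ^ 3 * theta (2 * γ) τ) := by rw [m2, neg_neg]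
    rw [hz, k1, k2, k3, k4, ← m1, m3]
    simp only [zpow_ofNat]
    ring

/-- Two of the shifts differ by ±kγ with 1 ≤ k ≤ 4, and θ(kγ) ≠ 0, so no two factors vanish
together. The case k = 4 uses a > 0. -/
lemma hasSimpleZeros_kernelDenominator {a t : ℝ} {c γ τ : ℂ} (ha : 0 < a)
    (h : IsUniformizingTriple a t c γ τ) : HasSimpleZeros (kernelDenominator γ τ) := by
  have hre := h.tau_re
  have hτ := h.tau_im_pos
  have s := (hasSimpleZeros_theta hre hτ).comp_add
  have d := differentiable_theta_add hτ
  have hne : ∀ p q : ℂ, theta (q - p) τ ≠ 0 → ∀ z, theta (z + p) τ = 0 → theta (z + q) τ ≠ 0 := by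
    intro p q hpq z hz
    have := theta_add_ne_zero hre hτ hz hpq
    rwa [show z + p + (q - p) = z + q by ring] at this
  have g1 := h.theta_gamma_ne_zero
  have g2 := h.theta_two_gamma_ne_zero
  have g3 := h.theta_three_gamma_ne_zero
  have g4 := h.theta_four_gamma_ne_zero ha
  have f1 : theta (-γ) τ ≠ 0 := by simpa using g1
  have f2 : theta (-(2 * γ)) τ ≠ 0 := by simpa using g2
  have f3 : theta (-(3 * γ)) τ ≠ 0 := by simpa using g3
  have f4 : theta (-(4 * γ)) τ ≠ 0 := by simpa using g4
  have key : HasSimpleZeros (fun z => theta (z + 0) τ * theta (z + γ) τ * theta (z + -γ) τ *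
      theta (z + 2 * γ) τ * theta (z + -(2 * γ)) τ) := by
    have d2 := (d 0).fun_mul (d γ)
    have d3 := d2.fun_mul (d (-γ))
    have d4 := d3.fun_mul (d (2 * γ))
    refine HasSimpleZeros.mul (HasSimpleZeros.mul (HasSimpleZeros.mul (HasSimpleZeros.mul (s 0) (s γ)
      (d _) (d _) ?_) (s _) d2 (d _) ?_) (s _) d3 (d _) ?_) (s _) d4 (d _) ?_
    · exact hne 0 γ (by rwa [sub_zero])
    · intro z hz
      rcases mul_eq_zero.1 hz with hz | hz
      · exact hne 0 (-γ) (by rwa [sub_zero]) z hz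
      · exact hne γ (-γ) (by rwa [show -γ - γ = -(2 * γ) by ring]) z hz
    · intro z hz
      rcases mul_eq_zero.1 hz with hz | hz
      · rcases mul_eq_zero.1 hz with hz | hz
        · exact hne 0 (2 * γ) (by rwa [sub_zero]) z hz
        · exact hne γ (2 * γ) (by rwa [show 2 * γ - γ = γ by ring]) z hz
      · exact hne (-γ) (2 * γ) (by rwa [show 2 * γ - -γ = 3 * γ by ring]) z hz
    · intro z hz
      rcases mul_eq_zero.1 hz with hz | hz
      · rcases mul_eq_zero.1 hz with hz | hz
        · rcases mul_eq_zero.1 hz with hz | hz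
          · exact hne 0 (-(2 * γ)) (by rwa [sub_zero]) z hz
          · exact hne γ (-(2 * γ)) (by rwa [show -(2 * γ) - γ = -(3 * γ) by ring]) z hz
        · exact hne (-γ) (-(2 * γ)) (by rwa [show -(2 * γ) - -γ = -γ by ring]) z hz
      · exact hne (2 * γ) (-(2 * γ)) (by rwa [show -(2 * γ) - 2 * γ = -(4 * γ) by ring]) z hz
  simp only [add_zero] at key
  exact key

/-- The parametrized kernel vanishes identically. -/
lemma kernelNumerator_eq_zero {a t : ℝ} {c γ τ : ℂ} (ha : 0 < a)
    (h : IsUniformizingTriple a t c γ τ) (z : ℂ) : kernelNumerator a t c γ τ z = 0 := by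
  have hτ := h.tau_im_pos
  have dD := differentiable_kernelDenominator (γ := γ) hτ
  have dN := differentiable_kernelNumerator (a := a) (t := t) (c := c) (γ := γ) hτ
  obtain ⟨r, dr, hr⟩ := exists_entire_quotient dN dD (hasSimpleZeros_kernelDenominator ha h)
    (fun z => kernelNumerator_eq_zero_of_kernelDenominator h)
  have h1 := h.theta_gamma_ne_zero
  have h2 := h.theta_two_gamma_ne_zero
  have hA : HasDerivAt (fun w => theta w τ) (theta' 0 τ) 0 := hasDerivAt_theta hτ 0
  have hs : ∀ s, HasDerivAt (fun w => theta (w + s) τ) (theta' s τ) 0 := by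
    intro s
    have := hasDerivAt_theta hτ (0 + s)
    rw [zero_add] at this
    exact HasDerivAt.comp_add_const 0 s (by rwa [zero_add])
  have hB := hs γ
  have hC := hs (-γ)
  have hD := hs (2 * γ)
  have hE := hs (-(2 * γ))
  rw [theta'_neg] at hC hE
  have hDen := (((hA.fun_mul hB).fun_mul hC).fun_mul hD).fun_mul hE
  have hNum := (((((((hA.fun_pow 2).fun_mul (hB.fun_pow 2)).fun_mul hE).const_mul (c ^ 2)).fun_add
    ((((hA.fun_pow 2).fun_mul (hC.fun_pow 2)).fun_mul hD).const_mul (c ^ 2))).fun_add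
    (((hC.fun_pow 2).fun_mul (hD.fun_pow 2)).fun_mul hE)).fun_add
    (((hB.fun_pow 2).fun_mul (hE.fun_pow 2)).fun_mul hD)).fun_add
    ((((hA.fun_pow 3).fun_mul hB).fun_mul hC).const_mul (a * c ^ 3)) |>.fun_sub
    (hDen.const_mul (c / t))
  have hNum' := hNum.deriv
  have hDen' := hDen.deriv
  simp only [zero_add, theta_zero, theta_neg] at hNum' hDen'
  -- The third equation, the one for c/t, says precisely that the numerator vanishes to second order
  -- at 0.
  have e1 : deriv (kernelNumerator a t c γ τ) 0 = 0 := by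
    unfold kernelNumerator
    rw [hNum']
    have := h.mul_theta'
    norm_num
    linear_combination (-theta γ τ * theta (2 * γ) τ ^ 2) * this
  have e2 : deriv (kernelDenominator γ τ) 0 = theta' 0 τ * theta γ τ ^ 2 * theta (2 * γ) τ ^ 2 := by
    unfold kernelDenominator
    rw [hDen']
    ring
  have e2' : deriv (kernelDenominator γ τ) 0 ≠ 0 := by
    rw [e2]
    exact mul_ne_zero (mul_ne_zero (theta'_zero_ne_zero h.tau_re hτ) (pow_ne_zero _ h1))
      (pow_ne_zero _ h2)
  have hD0 : kernelDenominator γ τ 0 = 0 := by simp [kernelDenominator]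
  have hne : ∃ z, kernelDenominator γ τ z ≠ 0 := by
    by_contra hcon
    push Not at hcon
    rw [show kernelDenominator γ τ = fun _ => 0 from funext hcon] at e2'
    simp at e2'
  -- The denominator has only a simple zero at 0, so the additional order of vanishing falls on the
  -- quotient `r`.
  have hr0 : r 0 = 0 := by
    have e3 : deriv (kernelNumerator a t c γ τ) 0 =
        deriv r 0 * kernelDenominator γ τ 0 + r 0 * deriv (kernelDenominator γ τ) 0 := by
      rw [show kernelNumerator a t c γ τ = fun z => r z * kernelDenominator γ τ z from funext hr,
        deriv_fun_mul (dr 0) (dD 0)]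
    rw [e1, hD0, mul_zero, zero_add] at e3
    exact (mul_eq_zero.1 e3.symm).resolve_right e2'
  have hconst : r z = r 0 := by
    refine eq_of_doublyPeriodic hτ dr ?_ ?_ z 0
    · exact periodic_quotient (u := fun _ => -1) dr.continuous dD hne (by simp) hr
        (fun z => kernel_add_pi z |>.1) (fun z => (kernel_add_pi (a := a) (t := t) (c := c) z).2)
    · exact periodic_quotient dr.continuous dD hne
        (u := fun z => (-Complex.exp (-(Complex.I * Real.pi * τ)) *
          Complex.exp (-(2 * Complex.I * z))) ^ 5)
        (fun z => pow_ne_zero _ (mul_ne_zero (neg_ne_zero.2 (Complex.exp_ne_zero _))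
          (Complex.exp_ne_zero _))) hr
        (fun z => (kernel_add_pi_mul hτ z).1)
        (fun z => (kernel_add_pi_mul (a := a) (t := t) (c := c) hτ z).2)
  rw [hr, hconst, hr0, zero_mul]

/-- The pair `(X(z), Y(z))` lies on the kernel curve. -/
lemma kernel_XY {a t : ℝ} {c γ τ : ℂ} (ha : 0 < a) (ht : 0 < t)
    (h : IsUniformizingTriple a t c γ τ) {z : ℂ}
    (hX : X c γ τ z ≠ 0) (hY : Y c γ τ z ≠ 0) :
    1 / (t : ℂ) = X c γ τ z + Y c γ τ z + 1 / X c γ τ z + 1 / Y c γ τ z +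
      a * X c γ τ z * Y c γ τ z := by
  have hc := h.c_ne_zero
  have ht0 : (t : ℂ) ≠ 0 := by exact_mod_cast ht.ne'
  have hk := kernelNumerator_eq_zero ha h z
  simp only [kernelNumerator, ← sub_eq_add_neg] at hk
  simp only [X, Y] at hX hY ⊢
  -- Division by zero gives 0, so X ≠ 0 and Y ≠ 0 exclude the poles as well as the zeros.
  have hA : theta z τ ≠ 0 := fun h0 => hX (by simp [h0])
  have hB : theta (z + γ) τ ≠ 0 := fun h0 => hX (by simp [h0])
  have hC : theta (z - γ) τ ≠ 0 := fun h0 => hX (by simp [h0])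
  have hD : theta (z + 2 * γ) τ ≠ 0 := fun h0 => hX (by simp [h0])
  have hE : theta (z - 2 * γ) τ ≠ 0 := fun h0 => hY (by simp [h0])
  generalize theta z τ = A at *
  generalize theta (z + γ) τ = B at *
  generalize theta (z - γ) τ = C at *
  generalize theta (z + 2 * γ) τ = D at *
  generalize theta (z - 2 * γ) τ = E at *
  field_simp at hk ⊢
  linear_combination -hk

/-! ### The regions where `|X| < 1` -/

/-- The closed horizontal strip `-Im γ ≤ Im z ≤ 0`. -/
def strip (γ : ℂ) : Set ℂ := {z | -γ.im ≤ z.im ∧ z.im ≤ 0}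

lemma convex_strip (γ : ℂ) : Convex ℝ (strip γ) :=
  (convex_halfSpace_im_ge _).inter (convex_halfSpace_im_le _)

/-- A continuous function of period `π` attains its maximal modulus on the strip. -/
lemma exists_isMaxOn_strip {f : ℂ → ℂ} {γ : ℂ} (hγ : 0 < γ.im) (hf : ContinuousOn f (strip γ))
    (hper : ∀ z, f (z + Real.pi) = f z) : ∃ z ∈ strip γ, ∀ w ∈ strip γ, ‖f w‖ ≤ ‖f z‖ := by
  set K : Set ℂ := Icc 0 Real.pi ×ℂ Icc (-γ.im) 0
  have hK : IsCompact K := isCompact_Icc.reProdIm isCompact_Icc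
  have hKS : K ⊆ strip γ := fun z hz => hz.2
  obtain ⟨z, hz, hmax⟩ := hK.exists_isMaxOn (f := fun z => ‖f z‖)
    ⟨0, by simp [K, Complex.mem_reProdIm, Real.pi_pos.le, hγ.le]⟩ (hf.mono hKS).norm
  refine ⟨z, hKS hz, fun w hw => ?_⟩
  have hp : Function.Periodic f (Real.pi : ℂ) := hper
  have hfl := Int.fract_nonneg (w.re / Real.pi)
  have hfl' := Int.fract_lt_one (w.re / Real.pi)
  have hw' : w + ((-⌊w.re / Real.pi⌋ : ℤ) : ℂ) * Real.pi ∈ K := by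
    have e : w.re + (-(⌊w.re / Real.pi⌋ : ℝ)) * Real.pi = Int.fract (w.re / Real.pi) * Real.pi := by
      rw [Int.fract]
      have := Real.pi_ne_zero
      field_simp
      ring
    have e1 : (w + ((-⌊w.re / Real.pi⌋ : ℤ) : ℂ) * Real.pi).re =
        Int.fract (w.re / Real.pi) * Real.pi := by
      rw [← e]
      simp
    have e2 : (w + ((-⌊w.re / Real.pi⌋ : ℤ) : ℂ) * Real.pi).im = w.im := by simp
    rw [Complex.mem_reProdIm, e1, e2]
    refine ⟨⟨mul_nonneg hfl Real.pi_pos.le, ?_⟩, hw⟩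
    exact mul_le_of_le_one_left Real.pi_pos.le hfl'.le
  have := hmax hw'
  simp only [mem_ofPred_eq] at this
  rwa [hp.int_mul] at this

/-- The set where `X` is finite and of modulus less than one. -/
def domainX (c γ τ : ℂ) : Set ℂ :=
  {z : ℂ | theta (z - γ) τ * theta (z + 2 * γ) τ ≠ 0 ∧ ‖X c γ τ z‖ < 1}

lemma regionX_subset (c γ τ : ℂ) : regionX c γ τ ⊆ domainX c γ τ :=
  connectedComponentIn_subset _ _

lemma continuous_denominator {γ τ : ℂ} (hτ : 0 < τ.im) :
    Continuous fun z => theta (z - γ) τ * theta (z + 2 * γ) τ := by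
  have h1 := (differentiable_theta_add hτ (-γ)).continuous
  have h2 := (differentiable_theta_add hτ (2 * γ)).continuous
  simp only [← sub_eq_add_neg] at h1
  exact h1.mul h2

lemma analyticAt_X {c γ τ z : ℂ} (hτ : 0 < τ.im)
    (hz : theta (z - γ) τ * theta (z + 2 * γ) τ ≠ 0) : AnalyticAt ℂ (X c γ τ) z := by
  have h0 := (differentiable_theta hτ).analyticAt z
  have h1 := (differentiable_theta_add hτ γ).analyticAt z
  have h2 := (differentiable_theta_add hτ (-γ)).analyticAt z
  have h3 := (differentiable_theta_add hτ (2 * γ)).analyticAt z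
  simp only [← sub_eq_add_neg] at h2
  exact analyticAt_const.mul ((h0.fun_mul h1).fun_div (h2.fun_mul h3) hz)

lemma isOpen_domainX {c γ τ : ℂ} (hτ : 0 < τ.im) : IsOpen (domainX c γ τ) := by
  have ho : IsOpen {z : ℂ | theta (z - γ) τ * theta (z + 2 * γ) τ ≠ 0} :=
    (continuous_denominator hτ).isOpen_preimage _ isOpen_ne
  have hc : ContinuousOn (fun z => ‖X c γ τ z‖)
      {z : ℂ | theta (z - γ) τ * theta (z + 2 * γ) τ ≠ 0} :=
    fun z hz => (analyticAt_X hτ hz).continuousAt.continuousWithinAt.norm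
  exact hc.isOpen_inter_preimage ho isOpen_Iio

namespace IsUniformizingTriple

variable {a t : ℝ} {c γ τ : ℂ}

/-- On the strip Im(z - γ) lies in [-2 Im γ, -Im γ] and Im(z + 2γ) in [Im γ, 2 Im γ]; both avoid the
multiples of π Im τ because 0 < 2 Im γ < π Im τ. -/
lemma denominator_ne_zero (h : IsUniformizingTriple a t c γ τ) {z : ℂ} (hz : z ∈ strip γ) :
    theta (z - γ) τ * theta (z + 2 * γ) τ ≠ 0 := by
  have h1 := h.gamma_im_pos
  have h2 := h.two_gamma_im_lt
  obtain ⟨z1, z2⟩ := hz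
  refine mul_ne_zero (theta_ne_zero_of_im h.tau_re h.tau_im_pos (-1) ?_ ?_)
    (theta_ne_zero_of_im h.tau_re h.tau_im_pos 0 ?_ ?_)
  all_goals simp; linarith

lemma conj_X (h : IsUniformizingTriple a t c γ τ) (ha : 0 < a) (z : ℂ) :
    (starRingEnd ℂ) (X c γ τ z) = Y c γ τ ((starRingEnd ℂ) z) := by
  rw [X, Y]
  simp only [map_mul, map_div₀, theta_conj h.tau_re, map_add, map_sub, map_ofNat, h.conj_c ha,
    h.conj_gamma, mul_neg]
  simp only [← sub_eq_add_neg, sub_neg_eq_add, neg_mul, neg_neg]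

lemma X_zero (c γ τ : ℂ) : X c γ τ 0 = 0 := by simp [X]

/-- On the real line Y is the conjugate of X, and X(0) = 0. If |X| reached 1, then by continuity |X|
= |Y| = 1 at some point, and the kernel equation would give 1/t ≤ a + 4. -/
lemma norm_X_real (h : IsUniformizingTriple a t c γ τ) (ha : 0 < a) (ht : 0 < t)
    (hta : t < 1 / (a + 4)) (s : ℝ) : ‖X c γ τ s‖ < 1 := by
  by_contra hcon
  push Not at hcon
  have hs : ∀ s : ℝ, (s : ℂ) ∈ strip γ := fun s => by simp [strip, h.gamma_im_pos.le]
  have hcont : Continuous fun s : ℝ => ‖X c γ τ s‖ := by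
    rw [continuous_iff_continuousAt]
    intro s
    exact (ContinuousAt.comp (f := fun s : ℝ => (s : ℂ)) (g := X c γ τ)
      (analyticAt_X h.tau_im_pos (h.denominator_ne_zero (hs s))).continuousAt
      Complex.continuous_ofReal.continuousAt).norm
  obtain ⟨r, hr⟩ := mem_range_of_exists_le_of_exists_ge hcont ⟨0, by simp [X_zero]⟩ ⟨s, hcon⟩
  replace hr : ‖X c γ τ r‖ = 1 := hr
  have hY : Y c γ τ r = (starRingEnd ℂ) (X c γ τ r) := by rw [h.conj_X ha, Complex.conj_ofReal]
  have hYn : ‖Y c γ τ r‖ = 1 := by rw [hY, RCLike.norm_conj, hr]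
  have hX0 : X c γ τ r ≠ 0 := by
    intro h0
    simp [h0] at hr
  have hY0 : Y c γ τ r ≠ 0 := by
    intro h0
    simp [h0] at hYn
  have hk := congrArg norm (kernel_XY ha ht h hX0 hY0)
  have hle : ‖X c γ τ r + Y c γ τ r + 1 / X c γ τ r + 1 / Y c γ τ r +
      a * X c γ τ r * Y c γ τ r‖ ≤ 1 + 1 + 1 + 1 + a := by
    refine norm_add_le_of_le (norm_add_le_of_le (norm_add_le_of_le (norm_add_le_of_le hr.le hYn.le)
      ?_) ?_) ?_
    · simp [hr]
    · simp [hYn]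
    · simp [hr, hYn, abs_of_pos ha]
  rw [← hk, norm_div, norm_one, Complex.norm_real, Real.norm_of_nonneg ht.le, div_le_iff₀ ht] at hle
  rw [lt_div_iff₀ (by positivity)] at hta
  linarith

/-- Maximum principle on the strip: its lower edge is reflected to the real line by `X_symm`, and an
interior maximum would make X constant, equal to X(0) = 0. -/
lemma norm_X_lt_one (h : IsUniformizingTriple a t c γ τ) (ha : 0 < a) (ht : 0 < t)
    (hta : t < 1 / (a + 4)) {z : ℂ} (hz : z ∈ strip γ) : ‖X c γ τ z‖ < 1 := by
  have hγ := h.gamma_im_pos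
  have han : ∀ z ∈ strip γ, AnalyticAt ℂ (X c γ τ) z := fun z hz =>
    analyticAt_X h.tau_im_pos (h.denominator_ne_zero hz)
  have hreal : ∀ w : ℂ, w.im = 0 → ‖X c γ τ w‖ < 1 := by
    intro w hw
    have : w = (w.re : ℂ) := by apply Complex.ext <;> simp [hw]
    rw [this]
    exact h.norm_X_real ha ht hta _
  obtain ⟨p, hp, hmax⟩ := exists_isMaxOn_strip hγ
    (fun z hz => (han z hz).continuousAt.continuousWithinAt) (X_add_pi c γ τ)
  refine (hmax z hz).trans_lt ?_
  rcases hp.1.eq_or_lt with h1 | h1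
  · rw [← X_symm]
    exact hreal _ (by simp [← h1])
  rcases hp.2.eq_or_lt with h2 | h2
  · exact hreal p h2
  have hev : ∀ᶠ w in 𝓝 p, w ∈ strip γ := by
    filter_upwards [(isOpen_Ioo.preimage Complex.continuous_im).mem_nhds
      (show p ∈ Complex.im ⁻¹' Ioo (-γ.im) 0 from ⟨h1, h2⟩)] with w hw
    exact ⟨hw.1.le, hw.2.le⟩
  have hloc : IsLocalMax (norm ∘ X c γ τ) p := hev.mono fun w hw => hmax w hw
  have hconst := Complex.eventually_eq_of_isLocalMax_norm
    (hev.mono fun w hw => (han w hw).differentiableAt) hloc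
  have hall := AnalyticOnNhd.eqOn_of_preconnected_of_eventuallyEq han
    (analyticOnNhd_const (v := X c γ τ p)) (convex_strip γ).isPreconnected hp hconst
  have h0 := hall (show (0 : ℂ) ∈ strip γ by simp [strip, hγ.le])
  simp only [X_zero] at h0
  rw [← h0]
  simp

lemma neg_half_gamma_mem_strip (h : IsUniformizingTriple a t c γ τ) : -(γ / 2) ∈ strip γ := by
  have := h.gamma_im_pos
  constructor <;> simp <;> linarith

lemma strip_subset_domainX (h : IsUniformizingTriple a t c γ τ) (ha : 0 < a) (ht : 0 < t)
    (hta : t < 1 / (a + 4)) : strip γ ⊆ domainX c γ τ := fun _ hz =>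
  ⟨h.denominator_ne_zero hz, h.norm_X_lt_one ha ht hta hz⟩

lemma strip_subset_regionX (h : IsUniformizingTriple a t c γ τ) (ha : 0 < a) (ht : 0 < t)
    (hta : t < 1 / (a + 4)) : strip γ ⊆ regionX c γ τ :=
  (convex_strip γ).isPreconnected.subset_connectedComponentIn h.neg_half_gamma_mem_strip
    (h.strip_subset_domainX ha ht hta)

lemma isOpen_regionX (h : IsUniformizingTriple a t c γ τ) : IsOpen (regionX c γ τ) :=
  (isOpen_domainX h.tau_im_pos).connectedComponentIn

lemma neg_mem_regionX (h : IsUniformizingTriple a t c γ τ) (ha : 0 < a) (ht : 0 < t)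
    (hta : t < 1 / (a + 4)) {z : ℂ} (hz : z ∈ regionY c γ τ) : -z ∈ regionX c γ τ := by
  have hiff : ∀ w : ℂ, (theta (w + γ) τ * theta (w - 2 * γ) τ ≠ 0 ∧ ‖Y c γ τ w‖ < 1) ↔
      -w ∈ domainX c γ τ := by
    intro w
    rw [domainX, mem_ofPred_eq, Y_eq_X_neg, show -w - γ = -(w + γ) by ring,
      show -w + 2 * γ = -(w - 2 * γ) by ring, theta_neg, theta_neg, neg_mul_neg]
  have hpre : IsPreconnected ((fun w : ℂ => -w) '' regionY c γ τ) :=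
    isPreconnected_connectedComponentIn.image _ continuous_neg.continuousOn
  have hmem : γ / 2 ∈ regionY c γ τ := by
    refine mem_connectedComponentIn ?_
    rw [mem_ofPred_eq, hiff]
    exact h.strip_subset_domainX ha ht hta h.neg_half_gamma_mem_strip
  refine hpre.subset_connectedComponentIn (mem_image_of_mem _ hmem) ?_ (mem_image_of_mem _ hz)
  rintro _ ⟨w, hw, rfl⟩
  have hw' := connectedComponentIn_subset _ _ hw
  exact (hiff w).1 hw'

lemma analyticAt_X_of_mem (h : IsUniformizingTriple a t c γ τ) {z : ℂ} (hz : z ∈ domainX c γ τ) :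
    AnalyticAt ℂ (X c γ τ) z := analyticAt_X h.tau_im_pos hz.1

lemma X_neg_half_gamma_ne_zero (h : IsUniformizingTriple a t c γ τ) : X c γ τ (-(γ / 2)) ≠ 0 := by
  have h1 := h.gamma_im_pos
  have h2 := h.two_gamma_im_lt
  have h3 := h.denominator_ne_zero h.neg_half_gamma_mem_strip
  refine mul_ne_zero h.c_ne_zero (div_ne_zero (mul_ne_zero ?_ ?_) h3)
  · exact theta_ne_zero_of_im h.tau_re h.tau_im_pos (-1) (by simp; linarith) (by simp; linarith)
  · exact theta_ne_zero_of_im h.tau_re h.tau_im_pos 0 (by simp; linarith) (by simp; linarith)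

lemma domainX_add_lattice (h : IsUniformizingTriple a t c γ τ) (m n : ℤ) {z : ℂ} :
    z + (m * Real.pi + n * (Real.pi * τ)) ∈ domainX c γ τ ↔ z ∈ domainX c γ τ := by
  have hth : ∀ s, theta (z + (m * Real.pi + n * (Real.pi * τ)) + s) τ = 0 ↔ theta (z + s) τ = 0 := by
    intro s
    obtain ⟨κ, h0, hk⟩ := exists_theta_add_lattice h.tau_im_pos m n
    rw [add_right_comm, hk, mul_eq_zero, or_iff_right]
    exact mul_ne_zero h0 (Complex.exp_ne_zero _)
  rw [domainX, mem_ofPred_eq, mem_ofPred_eq, periodic_lattice (X_add_pi c γ τ)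
    (X_add_pi_mul h.tau_im_pos)]
  simp only [ne_eq, mul_eq_zero, sub_eq_add_neg, hth]

/-- The function `X` maps its region onto the unit disk. -/
lemma exists_mem_regionX (h : IsUniformizingTriple a t c γ τ) (ha : 0 < a) (ht : 0 < t)
    (hta : t < 1 / (a + 4)) {x : ℂ} (hx : ‖x‖ < 1) : ∃ z ∈ regionX c γ τ, X c γ τ z = x := by
  have hτ := h.tau_im_pos
  have hsub := regionX_subset c γ τ
  have hS := h.strip_subset_regionX ha ht hta
  have h0 : (0 : ℂ) ∈ regionX c γ τ := hS (by simp [strip, h.gamma_im_pos.le])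
  -- Open mapping theorem; X is not constant, as it vanishes at 0 and not at -γ/2.
  have hopen : IsOpen (X c γ τ '' regionX c γ τ) := by
    rcases AnalyticOnNhd.is_constant_or_isOpen (fun z hz => h.analyticAt_X_of_mem (hsub hz))
      (isPreconnected_connectedComponentIn (F := domainX c γ τ) (x := -(γ / 2))) with hc | ho
    · obtain ⟨w, hw⟩ := hc
      have e1 := hw 0 h0
      have e2 := hw _ (hS h.neg_half_gamma_mem_strip)
      rw [X_zero] at e1
      exact absurd (e2.trans e1.symm) h.X_neg_half_gamma_ne_zero
    · exact ho _ subset_rfl h.isOpen_regionX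
  -- The preimages may escape to infinity, so they are first translated by lattice vectors into the
  -- compact fundamental cell, where a subsequence converges to some `p`.
  have hclosed : ∀ y : ℂ, ‖y‖ < 1 → y ∈ closure (X c γ τ '' regionX c γ τ) →
      y ∈ X c γ τ '' regionX c γ τ := by
    intro y hy hcl
    obtain ⟨u, hu, hlim⟩ := mem_closure_iff_seq_limit.1 hcl
    choose v hv hvu using hu
    choose m n hmn using fun k => exists_translate_mem_fundamentalCell hτ (v k)
    obtain ⟨p, -, φ, hφ, hp⟩ := (isCompact_fundamentalCell τ).tendsto_subseq hmn
    have hXv : ∀ k, X c γ τ (v k + (m k * Real.pi + n k * (Real.pi * τ))) = u k := fun k => by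
      rw [periodic_lattice (X_add_pi c γ τ) (X_add_pi_mul hτ), hvu]
    have hnum : Continuous fun z => c * (theta z τ * theta (z + γ) τ) :=
      continuous_const.mul ((continuous_theta hτ).mul (differentiable_theta_add hτ γ).continuous)
    have heq : c * (theta p τ * theta (p + γ) τ) =
        y * (theta (p - γ) τ * theta (p + 2 * γ) τ) := by
      refine tendsto_nhds_unique ((hnum.tendsto p).comp hp) ?_
      refine ((hlim.comp hφ.tendsto_atTop).mul
        (((continuous_denominator (γ := γ) hτ).tendsto p).comp hp)).congr fun k => ?_
      have hd := ((h.domainX_add_lattice (m (φ k)) (n (φ k))).2 (hsub (hv (φ k)))).1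
      simp only [Function.comp_apply]
      rw [← hXv, X, mul_assoc, div_mul_cancel₀ _ hd]
    have hne : ∀ s s' : ℂ, theta (s' - s) τ ≠ 0 → theta (p + s) τ = 0 → theta (p + s') τ ≠ 0 := by
      intro s s' hss hs
      have := theta_add_ne_zero h.tau_re hτ hs hss
      rwa [show p + s + (s' - s) = p + s' by ring] at this
    have f1 : theta (-γ) τ ≠ 0 := by simpa using h.theta_gamma_ne_zero
    have f2 : theta (-(2 * γ)) τ ≠ 0 := by simpa using h.theta_two_gamma_ne_zero
    -- The limit relation was kept free of denominators; a pole at `p` would be a common zero of the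
    -- numerator and denominator of X, and there is none.
    have hden : theta (p - γ) τ * theta (p + 2 * γ) τ ≠ 0 := by
      intro hz
      rw [hz, mul_zero, mul_eq_zero, or_iff_right h.c_ne_zero, mul_eq_zero] at heq
      rw [sub_eq_add_neg, mul_eq_zero] at hz
      rcases heq with e | e <;> rcases hz with e' | e'
      · exact hne 0 (-γ) (by simpa using f1) (by rwa [add_zero]) e'
      · exact hne 0 (2 * γ) (by simpa using h.theta_two_gamma_ne_zero) (by rwa [add_zero]) e'
      · exact hne γ (-γ) (by rwa [show -γ - γ = -(2 * γ) by ring]) e e'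
      · exact hne γ (2 * γ) (by rw [show 2 * γ - γ = γ by ring]; exact h.theta_gamma_ne_zero) e e'
    have hXp : X c γ τ p = y := by
      rw [X, ← mul_div_assoc, heq, mul_div_assoc, div_self hden, mul_one]
    have hpd : p ∈ domainX c γ τ := ⟨hden, by rwa [hXp]⟩
    obtain ⟨ε, hε, hball⟩ := Metric.isOpen_iff.1 (isOpen_domainX hτ) p hpd
    obtain ⟨k, hk⟩ := (hp.eventually (Metric.ball_mem_nhds p hε)).exists
    set ω : ℂ := m (φ k) * Real.pi + n (φ k) * (Real.pi * τ) with hω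
    have hk' : v (φ k) + ω ∈ Metric.ball p ε := hk
    -- The limit point may belong to a translate of the region. A ball around it, translated back,
    -- is connected and contains `v (φ k)`, hence lies in the region itself.
    have hsub2 : (fun z => z - ω) '' Metric.ball p ε ⊆ domainX c γ τ := by
      rintro _ ⟨z, hz, rfl⟩
      rw [← h.domainX_add_lattice (m (φ k)) (n (φ k)), ← hω, sub_add_cancel]
      exact hball hz
    have hpre : IsPreconnected ((fun z => z - ω) '' Metric.ball p ε) :=
      (convex_ball p ε).isPreconnected.image _ (by fun_prop)
    have hvm : v (φ k) ∈ (fun z => z - ω) '' Metric.ball p ε := ⟨_, hk', by simp⟩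
    have hcomp := hpre.subset_connectedComponentIn hvm hsub2
    have hmem : v (φ k) ∈ connectedComponentIn (domainX c γ τ) (-(γ / 2)) := hv (φ k)
    rw [← connectedComponentIn_eq hmem] at hcomp
    refine ⟨p - ω, hcomp ⟨p, Metric.mem_ball_self hε, rfl⟩, ?_⟩
    rw [← hXp, ← periodic_lattice (X_add_pi c γ τ) (X_add_pi_mul hτ) (m (φ k)) (n (φ k)), ← hω,
      sub_add_cancel]
  have hball : Metric.ball (0 : ℂ) 1 ⊆ X c γ τ '' regionX c γ τ := by
    refine (convex_ball (0 : ℂ) 1).isPreconnected.subset_of_closure_inter_subset hopen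
      ⟨0, by simp, 0, h0, X_zero c γ τ⟩ ?_
    rintro y ⟨hy1, hy2⟩
    exact hclosed y (by simpa using hy2) hy1
  obtain ⟨z, hz, hzx⟩ := hball (show x ∈ Metric.ball (0 : ℂ) 1 by simpa using hx)
  exact ⟨z, hz, hzx⟩

end IsUniformizingTriple

/-! ### Removable singularities -/

/-- The function `f` agrees with an analytic function on a punctured neighborhood of `p`. -/
def IsRemovableAt (f : ℂ → ℂ) (p : ℂ) : Prop :=
  ∃ g : ℂ → ℂ, AnalyticAt ℂ g p ∧ f =ᶠ[𝓝[≠] p] g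

/-- The function obtained from `f` by filling in the removable singularities. -/
noncomputable def fillIn (f : ℂ → ℂ) (p : ℂ) : ℂ := limUnder (𝓝[≠] p) f

lemma AnalyticAt.isRemovableAt {f : ℂ → ℂ} {p : ℂ} (hf : AnalyticAt ℂ f p) : IsRemovableAt f p :=
  ⟨f, hf, EventuallyEq.rfl⟩

lemma IsRemovableAt.of_comp_homeomorph {f : ℂ → ℂ} {p : ℂ} (φ : ℂ ≃ₜ ℂ) (hφ : AnalyticAt ℂ φ p)
    (hf : ∀ z, f (φ z) = f z) (h : IsRemovableAt f (φ p)) : IsRemovableAt f p := by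
  obtain ⟨g, hg, hfg⟩ := h
  refine ⟨g ∘ φ, hg.comp hφ, ?_⟩
  rw [← φ.map_punctured_nhds_eq, EventuallyEq, eventually_map] at hfg
  filter_upwards [hfg] with z hz
  rw [← hf z, hz, Function.comp_apply]

lemma fillIn_comp_homeomorph {f : ℂ → ℂ} (φ : ℂ ≃ₜ ℂ) (hf : ∀ z, f (φ z) = f z) (p : ℂ) :
    fillIn f (φ p) = fillIn f p := by
  unfold fillIn limUnder
  rw [← φ.map_punctured_nhds_eq, map_map, show f ∘ φ = f from funext hf]

/-- At points q ≠ p close to p the functions f and g agree on a full neighborhood of q, so the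
punctured limit of f is g(q) there too. -/
lemma IsRemovableAt.fillIn_spec {f : ℂ → ℂ} {p : ℂ} (h : IsRemovableAt f p) :
    AnalyticAt ℂ (fillIn f) p ∧ fillIn f =ᶠ[𝓝[≠] p] f := by
  obtain ⟨g, hg, hfg⟩ := h
  have hlim : ∀ q, ContinuousAt g q → f =ᶠ[𝓝[≠] q] g → fillIn f q = g q := by
    intro q hq hfq
    exact ((hq.tendsto.mono_left nhdsWithin_le_nhds).congr' hfq.symm).limUnder_eq
  have hev : ∀ᶠ q in 𝓝 p, fillIn f q = g q := by
    have h1 : ∀ᶠ q in 𝓝 p, AnalyticAt ℂ g q := hg.eventually_analyticAt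
    have h2 : ∀ᶠ q in 𝓝[≠] p, ∀ᶠ z in 𝓝[≠] q, f z = g z := by
      have := eventually_eventually_nhdsWithin.2 hfg
      filter_upwards [this, self_mem_nhdsWithin] with q hq hqp
      have hq' : ∀ᶠ z in 𝓝 q, f z = g z := by
        rwa [isOpen_compl_singleton.nhdsWithin_eq hqp] at hq
      exact hq'.filter_mono nhdsWithin_le_nhds
    rw [eventually_nhdsWithin_iff] at h2
    filter_upwards [h1, h2] with q hq1 hq2
    by_cases hqp : q = p
    · subst hqp
      exact hlim q hq1.continuousAt hfg
    · exact hlim q hq1.continuousAt (hq2 hqp)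
  exact ⟨hg.congr (EventuallyEq.symm hev), EventuallyEq.trans (hev.filter_mono nhdsWithin_le_nhds) hfg.symm⟩

lemma analyticAt_dslope {f : ℂ → ℂ} {p : ℂ} (hf : AnalyticAt ℂ f p) :
    AnalyticAt ℂ (dslope f p) p := by
  obtain ⟨q, hq⟩ := hf
  exact ⟨_, hq.has_fpower_series_dslope_fslope⟩

/-- The sum of two simple poles with opposite residues is removable. -/
lemma isRemovableAt_div_add_div {u₁ v₁ u₂ v₂ : ℂ → ℂ} {p : ℂ} (hu₁ : AnalyticAt ℂ u₁ p)
    (hv₁ : AnalyticAt ℂ v₁ p) (hu₂ : AnalyticAt ℂ u₂ p) (hv₂ : AnalyticAt ℂ v₂ p)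
    (h₁ : v₁ p = 0) (h₂ : v₂ p = 0) (hd₁ : deriv v₁ p ≠ 0) (hd₂ : deriv v₂ p ≠ 0)
    (hres : u₁ p / deriv v₁ p + u₂ p / deriv v₂ p = 0) :
    IsRemovableAt (fun z => u₁ z / v₁ z + u₂ z / v₂ z) p := by
  -- `k` is the sum multiplied by z - p; its value at `p` is the total residue, so `k` is divisible
  -- by z - p.
  set k : ℂ → ℂ := fun z => u₁ z / dslope v₁ p z + u₂ z / dslope v₂ p z with hk
  have hkan : AnalyticAt ℂ k p :=
    (hu₁.fun_div (analyticAt_dslope hv₁) (by rwa [dslope_same])).fun_add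
      (hu₂.fun_div (analyticAt_dslope hv₂) (by rwa [dslope_same]))
  have hk0 : k p = 0 := by
    simp only [hk, dslope_same]
    exact hres
  refine ⟨dslope k p, analyticAt_dslope hkan, ?_⟩
  filter_upwards [self_mem_nhdsWithin] with z hz
  have hz' : z ≠ p := hz
  have hzp : z - p ≠ 0 := sub_ne_zero.2 hz'
  rw [dslope_of_ne _ hz', slope_def_field, hk0, sub_zero]
  simp only [hk, dslope_of_ne _ hz', slope_def_field, h₁, h₂, sub_zero]
  rw [div_div_eq_mul_div, div_div_eq_mul_div, add_div, div_right_comm, mul_div_cancel_right₀ _ hzp,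
    div_right_comm (u₂ z * (z - p)), mul_div_cancel_right₀ _ hzp]

/-! ### The explicit theta quotient -/

lemma theta_add_half_pi_neg (z τ : ℂ) :
    theta (-z + Real.pi / 2) τ = theta (z + Real.pi / 2) τ := by
  have := theta_add_pi (τ := τ) (-z - Real.pi / 2)
  rw [show -z - (Real.pi : ℂ) / 2 + Real.pi = -z + Real.pi / 2 by ring] at this
  rw [this, show -z - (Real.pi : ℂ) / 2 = -(z + Real.pi / 2) by ring, theta_neg, neg_neg]

lemma thetaQuotient_neg (c γ τ z : ℂ) : thetaQuotient c γ τ (-z) = -thetaQuotient c γ τ z := by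
  rw [thetaQuotient, thetaQuotient, theta_add_half_pi_neg, theta_neg, mul_neg, div_neg]

lemma thetaQuotient_add_pi (c γ τ z : ℂ) :
    thetaQuotient c γ τ (z + Real.pi) = thetaQuotient c γ τ z := by
  rw [thetaQuotient, thetaQuotient, add_right_comm, theta_add_pi, theta_add_pi, mul_neg, mul_neg,
    neg_div_neg_eq]

/-- The constant factor of the theta quotient. -/
noncomputable def quotientConst (c γ τ : ℂ) : ℂ :=
  (theta' 0 (γ / Real.pi) * theta (2 * γ) τ) / (c * theta (Real.pi / 2) (γ / Real.pi) * theta' 0 τ)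

lemma thetaQuotient_eq (c γ τ z : ℂ) : thetaQuotient c γ τ z =
    quotientConst c γ τ * theta (z + Real.pi / 2) (γ / Real.pi) / theta z (γ / Real.pi) := by
  rw [thetaQuotient, quotientConst]
  simp only [div_eq_mul_inv, mul_inv]
  ring

namespace IsUniformizingTriple

variable {a t : ℝ} {c γ τ : ℂ}

lemma nome_re (h : IsUniformizingTriple a t c γ τ) : (γ / Real.pi).re = 0 := by
  rw [Complex.div_ofReal_re, h.gamma_re, zero_div]

lemma nome_im (h : IsUniformizingTriple a t c γ τ) : 0 < (γ / Real.pi).im := by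
  rw [Complex.div_ofReal_im]
  exact div_pos h.gamma_im_pos Real.pi_pos

lemma pi_mul_nome (γ : ℂ) : Real.pi * (γ / Real.pi) = γ := by
  have : (Real.pi : ℂ) ≠ 0 := by exact_mod_cast Real.pi_ne_zero
  field_simp

/-- The quotient changes sign under z ↦ z + γ, since the shift by π/2 in the numerator contributes
e^{-iπ} = -1 to its multiplier; it is also odd, and the two signs cancel. -/
lemma thetaQuotient_symm (h : IsUniformizingTriple a t c γ τ) (z : ℂ) :
    thetaQuotient c γ τ (-γ - z) = thetaQuotient c γ τ z := by
  have h1 := theta_add_pi_mul h.nome_im z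
  have h2 := theta_add_pi_mul h.nome_im (z + Real.pi / 2)
  rw [pi_mul_nome] at h1 h2
  have e : Complex.exp (-(2 * Complex.I * (z + Real.pi / 2))) =
      -Complex.exp (-(2 * Complex.I * z)) := by
    rw [show -(2 * Complex.I * (z + Real.pi / 2)) =
      -(2 * Complex.I * z) - Real.pi * Complex.I by ring, Complex.exp_sub, Complex.exp_pi_mul_I]
    ring
  rw [show -γ - z = -(z + γ) by ring, thetaQuotient_neg, thetaQuotient_eq, thetaQuotient_eq,
    add_right_comm, h1, h2, e]
  set u := Complex.exp (-(Complex.I * Real.pi * (γ / Real.pi))) with hu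
  set v := Complex.exp (-(2 * Complex.I * z)) with hv
  have hu0 : -u * v ≠ 0 := mul_ne_zero (neg_ne_zero.2 (Complex.exp_ne_zero _)) (Complex.exp_ne_zero _)
  rw [← mul_div_mul_left (quotientConst c γ τ * theta (z + Real.pi / 2) (γ / Real.pi)) _ hu0,
    ← neg_div]
  congr 1
  ring

lemma analyticAt_theta_nome (h : IsUniformizingTriple a t c γ τ) (z : ℂ) :
    AnalyticAt ℂ (fun z => theta z (γ / Real.pi)) z :=
  (differentiable_theta h.nome_im).analyticAt z

lemma analyticAt_theta_nome_shift (h : IsUniformizingTriple a t c γ τ) (z : ℂ) :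
    AnalyticAt ℂ (fun z => theta (z + Real.pi / 2) (γ / Real.pi)) z :=
  (differentiable_theta_add h.nome_im _).analyticAt z

lemma meromorphic_thetaQuotient (h : IsUniformizingTriple a t c γ τ) :
    Meromorphic (thetaQuotient c γ τ) := by
  intro z
  rw [show thetaQuotient c γ τ = fun z => quotientConst c γ τ *
    theta (z + Real.pi / 2) (γ / Real.pi) / theta z (γ / Real.pi) from
    funext (thetaQuotient_eq c γ τ)]
  exact (analyticAt_const.fun_mul (h.analyticAt_theta_nome_shift z)).meromorphicAt.fun_div
    (h.analyticAt_theta_nome z).meromorphicAt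

lemma theta_shift_ne_zero (h : IsUniformizingTriple a t c γ τ) {z : ℂ}
    (hz : theta z (γ / Real.pi) = 0) : theta (z + Real.pi / 2) (γ / Real.pi) ≠ 0 :=
  theta_add_ne_zero h.nome_re h.nome_im hz (theta_pi_div_two_ne_zero h.nome_re h.nome_im)

lemma quotientConst_ne_zero (h : IsUniformizingTriple a t c γ τ) : quotientConst c γ τ ≠ 0 :=
  div_ne_zero (mul_ne_zero (theta'_zero_ne_zero h.nome_re h.nome_im) h.theta_two_gamma_ne_zero)
    (mul_ne_zero (mul_ne_zero h.c_ne_zero (theta_pi_div_two_ne_zero h.nome_re h.nome_im))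
      (theta'_zero_ne_zero h.tau_re h.tau_im_pos))

end IsUniformizingTriple

/-! ### Comparison of the decoupled function with the theta quotient. -/

/-- The polar part `1 / X + J`. -/
noncomputable def polarPart (c γ τ z : ℂ) : ℂ := 1 / X c γ τ z + thetaQuotient c γ τ z

/-- The regular part `1/(2t) - a t x Q(x, 0) - x` of the decoupled function. -/
noncomputable def regularPart (a t : ℝ) (x : ℂ) : ℂ := 1 / (2 * t) - a * t * x * Q a t x 0 - x

/-- The difference between the decoupled function and the theta quotient. -/
noncomputable def discrepancy (a t : ℝ) (c γ τ z : ℂ) : ℂ :=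
  regularPart a t (X c γ τ z) - polarPart c γ τ z

lemma analyticAt_regularPart {a t : ℝ} (ha : 0 < a) (ht : 0 < t) (hta : t < 1 / (a + 4)) {x : ℂ}
    (hx : ‖x‖ < 1) : AnalyticAt ℂ (regularPart a t) x := by
  have hQ : AnalyticAt ℂ (fun x => Q a t x 0) x :=
    (differentiableOn_Q ha ht hta).analyticAt (Metric.isOpen_ball.mem_nhds (by simpa using hx))
  unfold regularPart
  fun_prop

namespace IsUniformizingTriple

variable {a t : ℝ} {c γ τ : ℂ}

lemma analyticAt_regularPart_X (h : IsUniformizingTriple a t c γ τ) (ha : 0 < a) (ht : 0 < t)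
    (hta : t < 1 / (a + 4)) {z : ℂ} (hz : z ∈ domainX c γ τ) :
    AnalyticAt ℂ (fun z => regularPart a t (X c γ τ z)) z :=
  (analyticAt_regularPart ha ht hta hz.2).comp (h.analyticAt_X_of_mem hz)

lemma discrepancy_symm (h : IsUniformizingTriple a t c γ τ) (z : ℂ) :
    discrepancy a t c γ τ (-γ - z) = discrepancy a t c γ τ z := by
  rw [discrepancy, discrepancy, polarPart, polarPart, X_symm, h.thetaQuotient_symm]

lemma polarPart_symm (h : IsUniformizingTriple a t c γ τ) (z : ℂ) :
    polarPart c γ τ (-γ - z) = polarPart c γ τ z := by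
  rw [polarPart, polarPart, X_symm, h.thetaQuotient_symm]

lemma polarPart_add_pi (c γ τ z : ℂ) : polarPart c γ τ (z + Real.pi) = polarPart c γ τ z := by
  rw [polarPart, polarPart, X_add_pi, thetaQuotient_add_pi]

lemma discrepancy_add_pi (a t : ℝ) (c γ τ z : ℂ) :
    discrepancy a t c γ τ (z + Real.pi) = discrepancy a t c γ τ z := by
  rw [discrepancy, discrepancy, polarPart_add_pi, X_add_pi]

/-- This fixes the constant of the theta quotient: its residue at 0 is θ(2γ|τ)/(cθ'(0|τ)), the
opposite of the residue of 1/X. -/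
lemma isRemovableAt_polarPart_zero (h : IsUniformizingTriple a t c γ τ) :
    IsRemovableAt (polarPart c γ τ) 0 := by
  have hτ := h.tau_im_pos
  have d0 := differentiable_theta hτ
  have d := differentiable_theta_add hτ
  have han : ∀ s, AnalyticAt ℂ (fun z => theta (z + s) τ) 0 := fun s => (d s).analyticAt 0
  have hB : (fun z => theta (z + γ) τ) 0 ≠ 0 := by simpa using h.theta_gamma_ne_zero
  have key := isRemovableAt_div_add_div (p := 0)
    (u₁ := fun z => theta (z + -γ) τ * theta (z + 2 * γ) τ / (c * theta (z + γ) τ))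
    (v₁ := fun z => theta z τ)
    (u₂ := fun z => quotientConst c γ τ * theta (z + Real.pi / 2) (γ / Real.pi))
    (v₂ := fun z => theta z (γ / Real.pi))
    (((han _).fun_mul (han _)).fun_div (analyticAt_const.fun_mul (han _))
      (mul_ne_zero h.c_ne_zero hB)) (d0.analyticAt 0)
    (analyticAt_const.fun_mul (h.analyticAt_theta_nome_shift 0)) (h.analyticAt_theta_nome 0)
    (theta_zero _) (theta_zero _) (theta'_zero_ne_zero h.tau_re hτ)
    (theta'_zero_ne_zero h.nome_re h.nome_im) (by
      have e1 := theta'_zero_ne_zero h.tau_re hτ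
      have e2 := theta'_zero_ne_zero h.nome_re h.nome_im
      have e3 := theta_pi_div_two_ne_zero h.nome_re h.nome_im
      have e4 := h.theta_gamma_ne_zero
      have e5 := h.c_ne_zero
      change _ / theta' 0 τ + _ / theta' 0 (γ / Real.pi) = 0
      simp only [zero_add, theta_neg, quotientConst]
      generalize theta' 0 τ = x1 at *
      generalize theta' 0 (γ / Real.pi) = x2 at *
      generalize theta (Real.pi / 2) (γ / Real.pi) = x3 at *
      generalize theta γ τ = x4 at *
      generalize theta (2 * γ) τ = x5 at *
      field_simp
      ring)
  obtain ⟨g, hg, hfg⟩ := key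
  refine ⟨g, hg, EventuallyEq.trans (Eventually.of_forall fun z => ?_) hfg⟩
  simp only [polarPart, X, thetaQuotient_eq, sub_eq_add_neg]
  congr 1
  simp only [div_eq_mul_inv, mul_inv, inv_inv]
  ring

/-- In the strip X vanishes only on πℤ and -γ + πℤ, because 2 Im γ < π Im τ keeps the other lattice
rows away; these points are zeros of θ(·|γ/π). -/
lemma X_ne_zero_of_mem_strip (h : IsUniformizingTriple a t c γ τ) {p : ℂ} (hp : p ∈ strip γ)
    (hD : theta p (γ / Real.pi) ≠ 0) : X c γ τ p ≠ 0 := by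
  have hγ := h.gamma_im_pos
  have hγ2 := h.two_gamma_im_lt
  obtain ⟨hp1, hp2⟩ := hp
  have hn : ∀ n : ℤ, -γ.im ≤ n * (Real.pi * τ.im) → n * (Real.pi * τ.im) ≤ γ.im → n = 0 := by
    intro n h1 h2
    have hpos : 0 < Real.pi * τ.im := by linarith
    have l1 : (-1 : ℝ) < n := lt_of_mul_lt_mul_right (by linarith) hpos.le
    have l2 : (n : ℝ) < 1 := lt_of_mul_lt_mul_right (by linarith) hpos.le
    norm_cast at l1 l2
    omega
  have hA : theta p τ ≠ 0 := by
    intro h0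
    obtain ⟨m, n, hmn⟩ := (theta_eq_zero_iff h.tau_re h.tau_im_pos p).1 h0
    have him : p.im = n * (Real.pi * τ.im) := by simp [hmn]
    obtain rfl := hn n (by linarith) (by linarith)
    refine hD ((theta_eq_zero_iff h.nome_re h.nome_im p).2 ⟨m, 0, by rw [hmn]; simp⟩)
  have hB : theta (p + γ) τ ≠ 0 := by
    intro h0
    obtain ⟨m, n, hmn⟩ := (theta_eq_zero_iff h.tau_re h.tau_im_pos _).1 h0
    have him : p.im + γ.im = n * (Real.pi * τ.im) := by
      have := congrArg Complex.im hmn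
      simpa using this
    obtain rfl := hn n (by linarith) (by linarith)
    refine hD ((theta_eq_zero_iff h.nome_re h.nome_im p).2 ⟨m, -1, ?_⟩)
    rw [pi_mul_nome, eq_sub_of_add_eq hmn]
    push_cast
    ring
  exact mul_ne_zero h.c_ne_zero (div_ne_zero (mul_ne_zero hA hB) (h.denominator_ne_zero ⟨hp1, hp2⟩))

/-- All candidate poles in the strip are carried to 0 by the period π and the reflection z ↦ -γ - z.
-/
lemma isRemovableAt_polarPart (h : IsUniformizingTriple a t c γ τ) {p : ℂ} (hp : p ∈ strip γ) :
    IsRemovableAt (polarPart c γ τ) p := by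
  have hτ := h.tau_im_pos
  have hγ := h.gamma_im_pos
  have hmul : ∀ m : ℤ, IsRemovableAt (polarPart c γ τ) (m * Real.pi) := by
    intro m
    refine IsRemovableAt.of_comp_homeomorph (Homeomorph.addRight (-(m * Real.pi) : ℂ)) ?_ ?_ ?_
    · simp only [Homeomorph.coe_addRight]
      fun_prop
    · intro z
      have hper : Function.Periodic (polarPart c γ τ) (Real.pi : ℂ) := polarPart_add_pi c γ τ
      simp only [Homeomorph.coe_addRight]
      rw [← sub_eq_add_neg]
      exact hper.sub_int_mul_eq m
    · simpa using h.isRemovableAt_polarPart_zero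
  by_cases hD : theta p (γ / Real.pi) = 0
  · obtain ⟨m, n, hmn⟩ := (theta_eq_zero_iff h.nome_re h.nome_im p).1 hD
    rw [pi_mul_nome] at hmn
    have him : p.im = n * γ.im := by simp [hmn]
    have hn1 : (-1 : ℤ) ≤ n := by
      have := hp.1
      rw [him] at this
      have : (-1 : ℝ) ≤ n := le_of_mul_le_mul_right (by linarith) hγ
      exact_mod_cast this
    have hn0 : n ≤ 0 := by
      have := hp.2
      rw [him] at this
      have : (n : ℝ) ≤ 0 := by
        by_contra hcon
        push Not at hcon
        nlinarith
      exact_mod_cast this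
    obtain rfl | rfl : n = 0 ∨ n = -1 := by omega
    · simpa [hmn] using hmul m
    · refine IsRemovableAt.of_comp_homeomorph (Homeomorph.subLeft (-γ)) ?_ h.polarPart_symm ?_
      · simp only [Homeomorph.coe_subLeft]
        fun_prop
      · have := hmul (-m)
        simp only [Homeomorph.coe_subLeft, hmn]
        convert this using 1
        push_cast
        ring
  · refine AnalyticAt.isRemovableAt (AnalyticAt.add ?_ ?_)
    · exact analyticAt_const.fun_div (analyticAt_X hτ (h.denominator_ne_zero hp))
        (h.X_ne_zero_of_mem_strip hp hD)
    · rw [show thetaQuotient c γ τ = fun z => quotientConst c γ τ *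
        theta (z + Real.pi / 2) (γ / Real.pi) / theta z (γ / Real.pi) from
        funext (thetaQuotient_eq c γ τ)]
      exact (analyticAt_const.fun_mul (h.analyticAt_theta_nome_shift p)).fun_div
        (h.analyticAt_theta_nome p) hD

lemma isRemovableAt_discrepancy (h : IsUniformizingTriple a t c γ τ) (ha : 0 < a) (ht : 0 < t)
    (hta : t < 1 / (a + 4)) {p : ℂ} (hp : p ∈ strip γ) :
    IsRemovableAt (discrepancy a t c γ τ) p := by
  obtain ⟨g, hg, hfg⟩ := h.isRemovableAt_polarPart hp
  refine ⟨fun z => regularPart a t (X c γ τ z) - g z,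
    (h.analyticAt_regularPart_X ha ht hta (h.strip_subset_domainX ha ht hta hp)).fun_sub hg, ?_⟩
  filter_upwards [hfg] with z hz
  rw [discrepancy, hz]

/-- The functional equation of the walks, in terms of the discrepancy. -/
lemma discrepancy_neg (h : IsUniformizingTriple a t c γ τ) (ha : 0 < a) (ht : 0 < t)
    (hta : t < 1 / (a + 4)) {z : ℂ} (hz : z ∈ domainX c γ τ) (hz' : -z ∈ domainX c γ τ)
    (hX : X c γ τ z ≠ 0) (hX' : X c γ τ (-z) ≠ 0) :
    discrepancy a t c γ τ z = -discrepancy a t c γ τ (-z) := by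
  have hk := kernel_XY ha ht h hX (by rwa [Y_eq_X_neg])
  rw [Y_eq_X_neg] at hk
  have hQ := Q_kernel ha ht hta hz.2.le hz'.2.le hX hX' hk
  rw [Q_swap a t 0] at hQ
  have ht0 : (t : ℂ) ≠ 0 := by exact_mod_cast ht.ne'
  -- Each side carries half of 1/t. In the sum the kernel turns 1/t into terms in one variable plus
  -- axy, and a times `hQ` removes axy.
  have e : 1 / (2 * (t : ℂ)) = (1 / t) / 2 := by rw [div_div, mul_comm]
  rw [discrepancy, discrepancy, polarPart, polarPart, regularPart, regularPart, thetaQuotient_neg, e,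
    hk]
  linear_combination (-(a : ℂ)) * hQ

/-- The discrepancy vanishes on the strip. -/
lemma fillIn_discrepancy_eq_zero (h : IsUniformizingTriple a t c γ τ) (ha : 0 < a) (ht : 0 < t)
    (hta : t < 1 / (a + 4)) {z : ℂ} (hz : z ∈ strip γ) :
    fillIn (discrepancy a t c γ τ) z = 0 := by
  have hγ := h.gamma_im_pos
  have hrem : ∀ p ∈ strip γ, IsRemovableAt (discrepancy a t c γ τ) p := fun p hp =>
    h.isRemovableAt_discrepancy ha ht hta hp
  set G := fillIn (discrepancy a t c γ τ) with hG
  have han : AnalyticOnNhd ℂ G (strip γ) := fun p hp => (hrem p hp).fillIn_spec.1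
  have hper : ∀ z, G (z + Real.pi) = G z :=
    fillIn_comp_homeomorph (Homeomorph.addRight (Real.pi : ℂ)) (discrepancy_add_pi a t c γ τ)
  have hsymm : ∀ z, G (-γ - z) = G z :=
    fillIn_comp_homeomorph (Homeomorph.subLeft (-γ)) h.discrepancy_symm
  have hreal : ∀ p : ℂ, p.im = 0 → p ∈ strip γ := fun p hp => ⟨by rw [hp]; linarith, hp.le⟩
  -- Both w and -w are in the domain of X only near the real line, so oddness is proved there, off
  -- the singularities, and extended over them by continuity.
  have hodd : ∀ p : ℂ, p.im = 0 → ∀ᶠ w in 𝓝 p, G w = -G (-w) := by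
    intro p hp
    have hp1 := hreal p hp
    have hp2 := hreal (-p) (by simp [hp])
    have hneg : AnalyticAt ℂ (fun w : ℂ => G (-w)) p :=
      AnalyticAt.comp (g := G) (f := fun w : ℂ => -w) (han _ hp2) (by fun_prop)
    refine (ContinuousAt.eventuallyEq_nhds_iff_eventuallyEq_nhdsNE (han p hp1).continuousAt
      hneg.neg.continuousAt).1 ?_
    have htend : Tendsto (fun w : ℂ => -w) (𝓝[≠] p) (𝓝[≠] (-p)) :=
      ((Homeomorph.neg ℂ).map_punctured_nhds_eq p).le
    have e1 := (hrem p hp1).fillIn_spec.2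
    have e2 := htend.eventually (hrem (-p) hp2).fillIn_spec.2
    have hdom := (isOpen_domainX (c := c) (γ := γ) h.tau_im_pos)
    have m1 : ∀ q ∈ strip γ, ∀ᶠ w in 𝓝[≠] q, w ∈ domainX c γ τ := fun q hq =>
      nhdsWithin_le_nhds (hdom.mem_nhds (h.strip_subset_domainX ha ht hta hq))
    have m2 : ∀ q ∈ strip γ, ∀ᶠ w in 𝓝[≠] q, X c γ τ w ≠ 0 := by
      intro q hq
      have hXan : AnalyticOnNhd ℂ (X c γ τ) (strip γ) := fun w hw =>
        analyticAt_X h.tau_im_pos (h.denominator_ne_zero hw)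
      rcases (hXan q hq).eventually_eq_zero_or_eventually_ne_zero with h0 | h0
      · exact absurd (hXan.eqOn_zero_of_preconnected_of_eventuallyEq_zero
          (convex_strip γ).isPreconnected hq h0 h.neg_half_gamma_mem_strip)
          h.X_neg_half_gamma_ne_zero
      · exact h0
    filter_upwards [e1, e2, m1 p hp1, m2 p hp1, htend.eventually (m1 _ hp2),
      htend.eventually (m2 _ hp2)] with w w1 w2 w3 w4 w5 w6
    rw [Pi.neg_apply, hG, w1, w2]
    exact h.discrepancy_neg ha ht hta w3 w5 w4 w6
  obtain ⟨p, hp, hmax⟩ := exists_isMaxOn_strip hγ han.continuousOn hper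
  have hint : ∀ q : ℂ, -γ.im < q.im → ∀ᶠ w in 𝓝 q, -γ.im < w.im := fun q hq =>
    (isOpen_Ioi.preimage Complex.continuous_im).mem_nhds hq
  -- A maximum on the lower edge is reflected to the real line. At a real maximum `q`, a point w
  -- just above the line has |G(w)| = |G(-w)| with -w in the strip, so `q` is a local maximum in the
  -- whole plane.
  have hlocal : ∃ q ∈ strip γ, IsLocalMax (norm ∘ G) q := by
    have hline : ∀ q : ℂ, q.im = 0 → (∀ w ∈ strip γ, ‖G w‖ ≤ ‖G q‖) → IsLocalMax (norm ∘ G) q := by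
      intro q hq hqmax
      have hneg : ∀ᶠ w in 𝓝 q, -γ.im < (-w).im :=
        continuous_neg.continuousAt.eventually (hint (-q) (by simp [hq, hγ]))
      filter_upwards [hodd q hq, hint q (by rw [hq]; linarith), hneg] with w w1 w2 w3
      rcases le_total w.im 0 with hw | hw
      · exact hqmax w ⟨w2.le, hw⟩
      · simp only [Function.comp_apply]
        rw [w1, norm_neg]
        exact hqmax (-w) ⟨w3.le, by simpa using hw⟩
    rcases hp.1.eq_or_lt with h1 | h1
    · have him : (-γ - p).im = 0 := by simp [← h1]
      exact ⟨-γ - p, hreal _ him, hline _ him (fun w hw => by rw [hsymm]; exact hmax w hw)⟩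
    rcases hp.2.eq_or_lt with h2 | h2
    · exact ⟨p, hp, hline p h2 hmax⟩
    · refine ⟨p, hp, ?_⟩
      have hlt : ∀ᶠ w in 𝓝 p, w.im < 0 := (isOpen_Iio.preimage Complex.continuous_im).mem_nhds h2
      filter_upwards [hint p h1, hlt] with w w1 w2
      exact hmax w ⟨w1.le, w2.le⟩
  obtain ⟨q, hq, hqmax⟩ := hlocal
  have hconst := Complex.eventually_eq_of_isLocalMax_norm
    ((han q hq).eventually_analyticAt.mono fun w hw => hw.differentiableAt) hqmax
  have hall := han.eqOn_of_preconnected_of_eventuallyEq (analyticOnNhd_const (v := G q))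
    (convex_strip γ).isPreconnected hq hconst
  -- The constant is G(0), and oddness at 0 makes it vanish.
  have h0 := (hodd 0 (by simp)).self_of_nhds
  rw [neg_zero] at h0
  have h0' : G 0 = 0 := by
    have : (2 : ℂ) * G 0 = 0 := by linear_combination h0
    simpa using this
  rw [hall hz, ← hall (hreal 0 (by simp)), h0']

/-- The decoupled function is the theta quotient, cleared of denominators. -/
lemma decoupled_identity (h : IsUniformizingTriple a t c γ τ) (ha : 0 < a) (ht : 0 < t)
    (hta : t < 1 / (a + 4)) {z : ℂ} (hz : z ∈ regionX c γ τ) :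
    (regularPart a t (X c γ τ z) * X c γ τ z - 1) * theta z (γ / Real.pi) =
      quotientConst c γ τ * X c γ τ z * theta (z + Real.pi / 2) (γ / Real.pi) := by
  have hsub := regionX_subset c γ τ
  have hXan : AnalyticOnNhd ℂ (X c γ τ) (regionX c γ τ) := fun w hw => h.analyticAt_X_of_mem (hsub hw)
  have hS := h.neg_half_gamma_mem_strip
  have hγ := h.gamma_im_pos
  have hD : theta (-(γ / 2)) (γ / Real.pi) ≠ 0 := by
    refine theta_ne_zero_of_im h.nome_re h.nome_im (-1) ?_ ?_
    all_goals
      rw [Complex.div_ofReal_im]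
      have := Real.pi_ne_zero
      field_simp
      simp
      linarith
  have hX := h.X_ne_zero_of_mem_strip hS hD
  -- Multiplied by X and θ(·|γ/π), both sides are analytic on the connected region, even at the
  -- zeros of X, so equality near -γ/2 suffices.
  refine AnalyticOnNhd.eqOn_of_preconnected_of_eventuallyEq
    (f := fun z => (regularPart a t (X c γ τ z) * X c γ τ z - 1) * theta z (γ / Real.pi))
    (g := fun z => quotientConst c γ τ * X c γ τ z * theta (z + Real.pi / 2) (γ / Real.pi))
    (fun w hw => ((((h.analyticAt_regularPart_X ha ht hta (hsub hw)).fun_mul (hXan w hw)).fun_sub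
      analyticAt_const).fun_mul (h.analyticAt_theta_nome w)))
    (fun w hw => (analyticAt_const.fun_mul (hXan w hw)).fun_mul (h.analyticAt_theta_nome_shift w))
    isPreconnected_connectedComponentIn (h.strip_subset_regionX ha ht hta hS) ?_ hz
  have hspec := (h.isRemovableAt_discrepancy ha ht hta hS).fillIn_spec.2
  have hin : ∀ᶠ w in 𝓝 (-(γ / 2)), w ∈ strip γ := by
    filter_upwards [(isOpen_Ioo.preimage Complex.continuous_im).mem_nhds
      (show -(γ / 2) ∈ Complex.im ⁻¹' Ioo (-γ.im) 0 by simpa using hγ)] with w hw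
    exact ⟨hw.1.le, hw.2.le⟩
  have hne : ∀ᶠ w in 𝓝 (-(γ / 2)), X c γ τ w ≠ 0 :=
    (analyticAt_X h.tau_im_pos (h.denominator_ne_zero hS)).continuousAt.eventually_ne hX
  have hne' : ∀ᶠ w in 𝓝 (-(γ / 2)), theta w (γ / Real.pi) ≠ 0 :=
    (h.analyticAt_theta_nome _).continuousAt.eventually_ne hD
  refine (ContinuousAt.eventuallyEq_nhds_iff_eventuallyEq_nhdsNE ?_ ?_).1 ?_
  · exact ((((h.analyticAt_regularPart_X ha ht hta (h.strip_subset_domainX ha ht hta hS)).fun_mul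
      (analyticAt_X h.tau_im_pos (h.denominator_ne_zero hS))).fun_sub
      analyticAt_const).fun_mul (h.analyticAt_theta_nome _)).continuousAt
  · exact ((analyticAt_const.fun_mul (analyticAt_X h.tau_im_pos (h.denominator_ne_zero hS))).fun_mul
      (h.analyticAt_theta_nome_shift _)).continuousAt
  · filter_upwards [hspec, hin.filter_mono nhdsWithin_le_nhds, hne.filter_mono nhdsWithin_le_nhds,
      hne'.filter_mono nhdsWithin_le_nhds] with w w1 w2 w3 w4
    rw [h.fillIn_discrepancy_eq_zero ha ht hta w2, discrepancy, polarPart, thetaQuotient_eq] at w1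
    generalize theta w (γ / Real.pi) = D at *
    generalize theta (w + Real.pi / 2) (γ / Real.pi) = E at *
    generalize X c γ τ w = x at *
    field_simp at w1
    linear_combination -w1

/-- The theta quotient agrees with the decoupled function on the region of `X`. -/
lemma thetaQuotient_eq_on_regionX (h : IsUniformizingTriple a t c γ τ) (ha : 0 < a) (ht : 0 < t)
    (hta : t < 1 / (a + 4)) {z : ℂ} (hz : z ∈ regionX c γ τ) (hX : X c γ τ z ≠ 0) :
    thetaQuotient c γ τ z = regularPart a t (X c γ τ z) - 1 / X c γ τ z := by
  have hid := h.decoupled_identity ha ht hta hz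
  -- If it vanished, the identity would force the numerator of the theta quotient to vanish too, but
  -- θ(z) and θ(z + π/2) have no common zero.
  have hD : theta z (γ / Real.pi) ≠ 0 := by
    intro h0
    rw [h0, mul_zero] at hid
    exact mul_ne_zero (mul_ne_zero h.quotientConst_ne_zero hX) (h.theta_shift_ne_zero h0) hid.symm
  rw [thetaQuotient_eq]
  generalize theta z (γ / Real.pi) = D at *
  generalize theta (z + Real.pi / 2) (γ / Real.pi) = E at *
  generalize X c γ τ z = x at *
  field_simp
  linear_combination -hid

lemma isDecoupledFunction_thetaQuotient (h : IsUniformizingTriple a t c γ τ) (ha : 0 < a)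
    (ht : 0 < t) (hta : t < 1 / (a + 4)) :
    IsDecoupledFunction a t c γ τ (thetaQuotient c γ τ) where
  meromorphic := h.meromorphic_thetaQuotient
  eq_on_regionX z hz hX := by
    rw [h.thetaQuotient_eq_on_regionX ha ht hta hz hX, regularPart]
  eq_on_regionY z hz hY := by
    rw [Y_eq_X_neg] at hY ⊢
    have := h.thetaQuotient_eq_on_regionX ha ht hta (h.neg_mem_regionX ha ht hta hz) hY
    rw [thetaQuotient_neg, regularPart] at this
    rw [Q_swap a t 0]
    linear_combination -this

/-- Two decoupled functions agree outside a discrete set. -/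
lemma eventually_codiscrete_eq (h : IsUniformizingTriple a t c γ τ) (ha : 0 < a)
    (ht : 0 < t) (hta : t < 1 / (a + 4)) {J₁ J₂ : ℂ → ℂ} (h₁ : IsDecoupledFunction a t c γ τ J₁)
    (h₂ : IsDecoupledFunction a t c γ τ J₂) : ∀ᶠ z in codiscrete ℂ, J₁ z = J₂ z := by
  have hmer : Meromorphic (J₁ - J₂) := h₁.meromorphic.sub h₂.meromorphic
  have hS := h.neg_half_gamma_mem_strip
  have hR := h.strip_subset_regionX ha ht hta hS
  have hne : ∀ᶠ w in 𝓝 (-(γ / 2)), X c γ τ w ≠ 0 :=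
    (analyticAt_X h.tau_im_pos (h.denominator_ne_zero hS)).continuousAt.eventually_ne
      h.X_neg_half_gamma_ne_zero
  -- Identity theorem for meromorphic functions: infinite order at one point forces infinite order
  -- everywhere.
  have htop : meromorphicOrderAt (J₁ - J₂) (-(γ / 2)) = ⊤ := by
    rw [meromorphicOrderAt_eq_top_iff]
    refine Eventually.filter_mono nhdsWithin_le_nhds ?_
    filter_upwards [hne, h.isOpen_regionX.mem_nhds hR] with w hw hw'
    rw [Pi.sub_apply, h₁.eq_on_regionX w hw' hw, h₂.eq_on_regionX w hw' hw, sub_self]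
  have hall : ∀ z, meromorphicOrderAt (J₁ - J₂) z = ⊤ := by
    intro z
    by_contra hz
    exact (hmer.exists_meromorphicOrderAt_ne_top_iff_forall.1 ⟨z, hz⟩ _) htop
  rw [Filter.Eventually, mem_codiscrete]
  intro z
  rw [disjoint_principal_right, compl_compl]
  filter_upwards [meromorphicOrderAt_eq_top_iff.1 (hall z)] with w hw
  exact sub_eq_zero.1 hw

end IsUniformizingTriple

end QuadrantWalk

/-- Uniqueness is stated off a discrete set because `Meromorphic` does not constrain the values of a
function at isolated points, in particular at its poles. -/
theorem mainTheorem4 (a t : ℝ) (ha : 0 < a) (ht : 0 < t) (hta : t < 1 / (a + 4))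
    (c γ τ : ℂ) (h : QuadrantWalk.IsUniformizingTriple a t c γ τ) :
    QuadrantWalk.IsDecoupledFunction a t c γ τ (QuadrantWalk.thetaQuotient c γ τ) ∧
    (∀ J : ℂ → ℂ, QuadrantWalk.IsDecoupledFunction a t c γ τ J →
      ∀ᶠ z in Filter.codiscrete ℂ, J z = QuadrantWalk.thetaQuotient c γ τ z) ∧
    (∀ x : ℂ, x ≠ 0 → ‖x‖ < 1 →
      (∃ z ∈ QuadrantWalk.regionX c γ τ, QuadrantWalk.X c γ τ z = x) ∧
      ∀ z ∈ QuadrantWalk.regionX c γ τ, QuadrantWalk.X c γ τ z = x →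
        QuadrantWalk.Q a t x 0 =
          (1 / (2 * t) - x - 1 / x - QuadrantWalk.thetaQuotient c γ τ z) / (a * t * x)) := by
  have hdec := h.isDecoupledFunction_thetaQuotient ha ht hta
  refine ⟨hdec, fun J hJ => h.eventually_codiscrete_eq ha ht hta hJ hdec, fun x hx hx1 =>
    ⟨h.exists_mem_regionX ha ht hta hx1, ?_⟩⟩
  rintro z hz rfl
  have ha0 : (a : ℂ) ≠ 0 := by exact_mod_cast ha.ne'
  have ht0 : (t : ℂ) ≠ 0 := by exact_mod_cast ht.ne'
  rw [hdec.eq_on_regionX z hz hx, eq_div_iff (mul_ne_zero (mul_ne_zero ha0 ht0) hx)]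
  ring
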